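/- **Setting.** Let $\mathbb X$ be a connected metric space with metric $\rho$; write $\mathbb B(x,r)=\{y:\rho(x,y)\le r\}$ and $C_0(\mathbb X)$ for the real continuous functions vanishing at infinity. Let $\mu^*$ be a positive $\sigma$-finite Borel measure on $\mathbb X$, $0=\lambda_0\le\lambda_1\le\cdots$ with $\lambda_k\to\infty$, and let $\{\phi_k\}_{k\ge0}\subset L^1(\mu^*)\cap C_0(\mathbb X)$ be orthonormal in $L^2(\mu^*)$ with $\phi_0>0$ everywhere. Put $\Pi_n=\mathrm{span}\{\phi_k:\lambda_k<n\}$ and assume that $\bigcup_n\Pi_n$ is dense in $C_0(\mathbb X)$. A sequence $(a_n)$ of finite non-negative numbers is *fast decreasing* if $n^Sa_n\to0$ for every $S>0$. $(\mathbb X,\rho,\mu^*,\{\lambda_k\},\{\phi_k\})$ is assumed to be a *data space*, that is: 1. all balls $\mathbb B(x,r)$, $r>0$, are compact; 2. there are $q\ge1$, $\kappa>0$ with $\mu^*(\mathbb B(x,r))=\mu^*(\{y:\rho(x,y)<r\})\le\kappa r^q$ for all $x\in\mathbb X$, $r>0$; 3. with the same $q$ there are $\kappa_1,\kappa_2>0$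 such that for all $x,y\in\mathbb X$, $0<t\le1$, the series below converges and $\bigl|\sum_k e^{-\lambda_k^2t}\phi_k(x)\phi_k(y)\bigr|\le\kappa_1t^{-q/2}e^{-\kappa_2\rho(x,y)^2/t}$; 4. there are compact sets $\mathbb K_n$, $n\ge1$, such that $\mathrm{diam}(\mathbb K_n)\le c_1n^{c_2}$ for some $c_1,c_2>0$, and $\sup_{x\notin\mathbb K_n}\sum_{\lambda_k<n}\phi_k(x)^2$ and $\int_{\mathbb X\setminus\mathbb K_n}\bigl(\sum_{\lambda_k<n}\phi_k^2\bigr)^{1/2}d\mu^*$ are fast decreasing. For $1\le p\le\infty$, $w:\mathbb X\to\mathbb R$ and $f\in L^p(\mu^*)$ let $E_n(w;p,f)=\min_{P\in\Pi_n}\|f-Pw\|_{p}$ and $E_n(p,f)=E_n(1;p,f)$. Let $X^p=\{f\in L^p:E_n(p,f)\to0\}$, let $W_{\gamma,p,w}$ be the set of all $f\in L^p$ with $\|f\|_p+\sup_{n>0}n^\gamma E_n(w;p,f)<\infty$, write $W_{\gamma,p}=W_{\gamma,p,1}$, and let $C^\infty=\bigcap_{\gamma>0}W_{\gamma,\infty}$.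 For $x_0\in\mathbb X$, $W_{\gamma,p,w}(x_0)$ is the set of all $f$ for which there is $r>0$ such that $\phi f\in W_{\gamma,p,w}$ for every $\phi\in C^\infty$ supported on $\mathbb B(x_0,r)$; $W_{\gamma,p}(x_0)=W_{\gamma,p,1}(x_0)$. Assume further: * *(partition of unity)* for every $r>0$ there are $\psi_k\in C^\infty$, $k\ge 0$, with $0\le\psi_k\le1$, each supported on some ball of radius $r$, such that for every $x$ there is a finite set $F$ of indices with $\sum_{k\in F}\psi_k=1$ on $\mathbb B(x,r)$; * *(product assumption)* there are $A^*\ge1$ and $R_{j,k,n}\in\Pi_{A^*n}$ such that $\max_{\lambda_k,\lambda_j<n,\ p=1,\infty}\|\phi_k\phi_j-R_{j,k,n}\phi_0\|_p$ is fast decreasing in $n$. Let $h:\mathbb R\to[0,1]$ be $C^\infty$, even, non-increasing on $[0,\infty)$, $h(t)=1$ for $|t|\le1/2$ and $h(t)=0$ for $t\ge1$, and put $\Phi_n(x,y)=\sum_kh(\lambda_k/n)\phi_k(x)\phi_k(y)$. For kernels $\Psi_n:\mathbb X\times\mathbb X\to\mathbb R$ put $\sigma(\Psi_n;f)(x)=\int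 f(y)\Psi_n(x,y)\,d\mu^*(y)$, $\tau_0(\{\Psi_n\};f)=\sigma(\Psi_1;f)$ and $\tau_j(\{\Psi_n\};f)=\sigma(\Psi_{2^j};f)-\sigma(\Psi_{2^{j-1}};f)$ for $j\ge1$. For a ball $\mathbb B$ let $\|\cdot\|_{p,\mathbb B}$ be the $L^p(\mu^*)$ norm on $\mathbb B$. **Statement.** Let $\gamma>0$. There is a constant $c$, depending only on the data space, $h$ and $\gamma$, such that the following holds for all $1\le p\le\infty$, all $f\in X^p$, all $x_0\in\mathbb X$ and all sequences of measurable, not necessarily symmetric kernels $\{\Psi_n\}_{n\ge1}$ for which $$\sup_{x}\int_{\mathbb X}|\Psi_n(x,y)-\Phi_n(x,y)|\,d\mu^*(y)\quad\text{and}\quad\sup_{y}\int_{\mathbb X}|\Psi_n(x,y)-\Phi_n(x,y)|\,d\mu^*(x)$$ are fast decreasing. Write $$\mathcal E(\mathbb B)=\sup_{n\ge0}2^{n\gamma}\|f-\sigma(\Psi_{2^n};f)\|_{p,\mathbb B},\qquad \mathcal T_m(\mathbb B)=\sup_{j\ge m}2^{j\gamma}\|\tau_j(\{\Psi_n\};f)\|_{p,\mathbb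 B}.$$ (a) For every ball $\mathbb B$ centered at $x_0$, $\ \mathcal E(\mathbb B)\le c\,\mathcal T_1(\mathbb B)$, $\ \mathcal T_1(\mathbb B)\le c\,\mathcal E(\mathbb B)$, and $\ \|f\|_{p,\mathbb B}+\mathcal E(\mathbb B)\le c\,\mathcal T_0(\mathbb B)$, $\ \mathcal T_0(\mathbb B)\le c\,(\|f\|_{p,\mathbb B}+\mathcal E(\mathbb B))$. (Both sides may be infinite; in particular $\mathcal E(\mathbb B)<\infty$ if and only if $\mathcal T_0(\mathbb B)<\infty$.) (b) If $\mathcal E(\mathbb B)<\infty$ or $\mathcal T_0(\mathbb B)<\infty$ for some ball $\mathbb B$ centered at $x_0$, then $f\in W_{\gamma,p,\phi_0}(x_0)$. (c) If $f\in W_{\gamma,p}(x_0)$, then there is a ball $\mathbb B$ centered at $x_0$ with $\mathcal E(\mathbb B)<\infty$ and $\mathcal T_0(\mathbb B)<\infty$. -/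

import Mathlib

open MeasureTheory Filter Topology
open scoped ENNReal NNReal ZeroAtInfty

noncomputable section

/-- A sequence with values in `[0, ∞]` is fast decreasing if its terms (for `n ≥ 1`) are finite and
`n ^ S * a n → 0` for every `S > 0`. -/
def FastDecreasing (a : ℕ → ℝ≥0∞) : Prop :=
  (∀ n : ℕ, 1 ≤ n → a n < ∞) ∧
    ∀ S : ℝ, 0 < S → Tendsto (fun n : ℕ => (n : ℝ≥0∞) ^ S * a n) atTop (𝓝 0)

/-- A sequence has polynomial growth if `|a n| ≤ c₁ n ^ c₂` for all `n ≥ 1`. -/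
def PolynomialGrowth (a : ℕ → ℝ) : Prop :=
  ∃ c₁ c₂ : ℝ, 0 < c₁ ∧ 0 < c₂ ∧ ∀ n : ℕ, 1 ≤ n → |a n| ≤ c₁ * (n : ℝ) ^ c₂

/-- The measure `μ*`, the exponents `λ_k ↑ ∞` with `λ_0 = 0`, and the orthonormal system
`φ_k ∈ L¹ ∩ C₀` with `φ_0 > 0` whose span is dense in `C₀(X, ℝ)`. -/
structure DiffusionSystem (X : Type*) [MetricSpace X] [MeasurableSpace X] [BorelSpace X] where
  /-- the measure `μ*` -/
  μ : Measure X
  sigmaFinite : SigmaFinite μ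
  /-- the sequence `λ_k` -/
  lam : ℕ → ℝ
  lam_monotone : Monotone lam
  lam_zero : lam 0 = 0
  lam_tendsto : Tendsto lam atTop atTop
  /-- the orthonormal functions `φ_k` -/
  φ : ℕ → C₀(X, ℝ)
  φ_integrable : ∀ k, Integrable (fun x => φ k x) μ
  φ_orthonormal : ∀ j k, ∫ x, φ j x * φ k x ∂μ = if j = k then 1 else 0
  φ_zero_pos : ∀ x, 0 < φ 0 x
  dense_span : Dense (Submodule.span ℝ (Set.range φ) : Set C₀(X, ℝ))

namespace DiffusionSystem

variable {X : Type*} [MetricSpace X] [MeasurableSpace X] [BorelSpace X]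

/-- The diffusion polynomials `Π_n = span {φ_k : λ_k < n}`; it is `{0}` for `n ≤ 0`. -/
def diffPoly (Ξ : DiffusionSystem X) (n : ℝ) : Submodule ℝ C₀(X, ℝ) :=
  Submodule.span ℝ (Ξ.φ '' {k | Ξ.lam k < n})

/-- The function `∑_{λ_k < n} φ_k(x)²`; only finitely many terms are non-zero. -/
def christoffel (Ξ : DiffusionSystem X) (n : ℝ) (x : X) : ℝ :=
  ∑' k : ℕ, if Ξ.lam k < n then Ξ.φ k x ^ 2 else 0

/-- The data space axioms. -/
structure IsDataSpace (Ξ : DiffusionSystem X) : Prop where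
  isCompact_closedBall : ∀ (x : X) (r : ℝ), 0 < r → IsCompact (Metric.closedBall x r)
  /-- The ball measure condition and the Gaussian upper bound, with the same exponent `q`. -/
  ball_and_gaussian : ∃ q : ℝ, 1 ≤ q ∧
    (∃ κ : ℝ, 0 < κ ∧ ∀ (x : X) (r : ℝ), 0 < r →
      Ξ.μ (Metric.closedBall x r) = Ξ.μ (Metric.ball x r) ∧
      Ξ.μ (Metric.closedBall x r) ≤ ENNReal.ofReal (κ * r ^ q)) ∧
    (∃ κ₁ κ₂ : ℝ, 0 < κ₁ ∧ 0 < κ₂ ∧ ∀ (x y : X) (t : ℝ), 0 < t → t ≤ 1 →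
      Summable (fun k : ℕ => Real.exp (-(Ξ.lam k ^ 2 * t)) * Ξ.φ k x * Ξ.φ k y) ∧
      |∑' k : ℕ, Real.exp (-(Ξ.lam k ^ 2 * t)) * Ξ.φ k x * Ξ.φ k y| ≤
        κ₁ * t ^ (-q / 2) * Real.exp (-(κ₂ * (dist x y ^ 2 / t))))
  /-- Essential compactness. -/
  essential_compactness : ∃ K : ℕ → Set X, (∀ n, 1 ≤ n → IsCompact (K n)) ∧
    PolynomialGrowth (fun n => Metric.diam (K n)) ∧
    FastDecreasing (fun n => ⨆ x ∈ (K n)ᶜ, ENNReal.ofReal (Ξ.christoffel n x)) ∧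
    FastDecreasing (fun n => ∫⁻ x in (K n)ᶜ, ENNReal.ofReal (Real.sqrt (Ξ.christoffel n x)) ∂Ξ.μ)

/-- The product assumption: there are `A* ≥ 1` and `R_{j,k,n} ∈ Π_{A* n}` such that the maximum of
`‖φ_k φ_j - R_{j,k,n} φ_0‖_p` over `λ_k, λ_j < n` and `p = 1, ∞` is fast decreasing in `n`. -/
def ProductAssumption (Ξ : DiffusionSystem X) : Prop :=
  ∃ (A : ℝ) (R : ℕ → ℕ → ℕ → C₀(X, ℝ)), 1 ≤ A ∧
    (∀ j k n : ℕ, R j k n ∈ Ξ.diffPoly (A * n)) ∧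
    FastDecreasing (fun n : ℕ =>
      ⨆ (j : ℕ) (_ : Ξ.lam j < n) (k : ℕ) (_ : Ξ.lam k < n),
        max (eLpNorm (fun x => Ξ.φ k x * Ξ.φ j x - R j k n x * Ξ.φ 0 x) 1 Ξ.μ)
          (eLpNorm (fun x => Ξ.φ k x * Ξ.φ j x - R j k n x * Ξ.φ 0 x) ∞ Ξ.μ))

/-- The degree of approximation `E_n(w; p, f) = min_{P ∈ Π_n} ‖f - P w‖_p`. -/
def degApprox (Ξ : DiffusionSystem X) (w : X → ℝ) (p : ℝ≥0∞) (f : X → ℝ) (n : ℝ) : ℝ≥0∞ :=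
  ⨅ P ∈ Ξ.diffPoly n, eLpNorm (fun x => f x - P x * w x) p Ξ.μ

/-- The space `X^p` of all `f ∈ L^p` with `E_n(p, f) → 0`. -/
def MemXp (Ξ : DiffusionSystem X) (p : ℝ≥0∞) (f : X → ℝ) : Prop :=
  MemLp f p Ξ.μ ∧ Tendsto (fun n : ℝ => Ξ.degApprox (fun _ => 1) p f n) atTop (𝓝 0)

/-- The smoothness class `W_{γ,p,w}`. -/
def MemSobolev (Ξ : DiffusionSystem X) (γ : ℝ) (p : ℝ≥0∞) (w f : X → ℝ) : Prop :=
  MemLp f p Ξ.μ ∧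
    (⨆ (n : ℝ) (_ : 0 < n), ENNReal.ofReal (n ^ γ) * Ξ.degApprox w p f n) < ∞

/-- The class `C^∞ = ⋂_{γ > 0} W_{γ,∞}` (with weight `w ≡ 1`). -/
def IsSmooth (Ξ : DiffusionSystem X) (ψ : X → ℝ) : Prop :=
  ∀ γ : ℝ, 0 < γ → Ξ.MemSobolev γ ∞ (fun _ => 1) ψ

/-- The class `C^∞(𝔹(x, r))`: functions in `C^∞` supported on the closed ball `𝔹(x, r)`. -/
def IsSmoothOnBall (Ξ : DiffusionSystem X) (x : X) (r : ℝ) (ψ : X → ℝ) : Prop :=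
  Ξ.IsSmooth ψ ∧ ∀ y, y ∉ Metric.closedBall x r → ψ y = 0

/-- The local smoothness class `W_{γ,p,w}(x₀)`: for some ball around `x₀`, the product of `f` with
every `C^∞` function supported on this ball is in `W_{γ,p,w}`. -/
def MemLocalSobolev (Ξ : DiffusionSystem X) (γ : ℝ) (p : ℝ≥0∞) (w f : X → ℝ) (x₀ : X) : Prop :=
  ∃ r : ℝ, 0 < r ∧ ∀ ψ : X → ℝ, Ξ.IsSmoothOnBall x₀ r ψ →
    Ξ.MemSobolev γ p w (fun x => ψ x * f x)

/-- The partition of unity assumption. -/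
def PartitionOfUnity (Ξ : DiffusionSystem X) : Prop :=
  ∀ r : ℝ, 0 < r → ∃ ψ : ℕ → X → ℝ,
    (∀ k, ∃ x, Ξ.IsSmoothOnBall x r (ψ k)) ∧
    (∀ k x, 0 ≤ ψ k x ∧ ψ k x ≤ 1) ∧
    ∀ x, ∃ F : Finset ℕ, ∀ y ∈ Metric.closedBall x r, ∑ k ∈ F, ψ k y = 1

/-- The kernel `Φ_N(h; x, y) = ∑_k h(λ_k / N) φ_k(x) φ_k(y)`; for `N > 0` and `h` vanishing on
`[1, ∞)` only finitely many terms are non-zero. -/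
def kernelΦ (Ξ : DiffusionSystem X) (h : ℝ → ℝ) (N : ℝ) (x y : X) : ℝ :=
  ∑' k : ℕ, h (Ξ.lam k / N) * Ξ.φ k x * Ξ.φ k y

/-- `σ(Ψ; f)(x) = ∫ f(y) Ψ(x, y) dμ*(y)`. -/
def netOp (Ξ : DiffusionSystem X) (Ψ : X → X → ℝ) (f : X → ℝ) (x : X) : ℝ :=
  ∫ y, f y * Ψ x y ∂Ξ.μ

/-- `τ_0({Ψ_n}; f) = σ(Ψ_1; f)` and `τ_j({Ψ_n}; f) = σ(Ψ_{2^j}; f) - σ(Ψ_{2^(j-1)}; f)`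
for `j ≥ 1`. -/
def netTau (Ξ : DiffusionSystem X) (Ψ : ℕ → X → X → ℝ) (f : X → ℝ) : ℕ → X → ℝ
  | 0 => fun x => Ξ.netOp (Ψ 1) f x
  | j + 1 => fun x => Ξ.netOp (Ψ (2 ^ (j + 1))) f x - Ξ.netOp (Ψ (2 ^ j)) f x

/-- The local norm `‖f‖_{p, μ*, 𝔹(x₀, r)}` on the closed ball. -/
def ballNorm (Ξ : DiffusionSystem X) (p : ℝ≥0∞) (x₀ : X) (r : ℝ) (f : X → ℝ) : ℝ≥0∞ :=
  eLpNorm f p (Ξ.μ.restrict (Metric.closedBall x₀ r))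

/-- `sup_{n ≥ 0} 2^{nγ} ‖f - σ(Ψ_{2^n}; f)‖_{p, μ*, 𝔹(x₀, r)}`. -/
def errSup (Ξ : DiffusionSystem X) (Ψ : ℕ → X → X → ℝ) (γ : ℝ) (p : ℝ≥0∞) (x₀ : X) (r : ℝ)
    (f : X → ℝ) : ℝ≥0∞ :=
  ⨆ n : ℕ, ENNReal.ofReal ((2 : ℝ) ^ ((n : ℝ) * γ)) *
    Ξ.ballNorm p x₀ r (fun x => f x - Ξ.netOp (Ψ (2 ^ n)) f x)

/-- `sup_{j ≥ m} 2^{jγ} ‖τ_j({Ψ_n}; f)‖_{p, μ*, 𝔹(x₀, r)}`. -/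
def tauSup (Ξ : DiffusionSystem X) (Ψ : ℕ → X → X → ℝ) (γ : ℝ) (p : ℝ≥0∞) (x₀ : X) (r : ℝ)
    (f : X → ℝ) (m : ℕ) : ℝ≥0∞ :=
  ⨆ (j : ℕ) (_ : m ≤ j), ENNReal.ofReal ((2 : ℝ) ^ ((j : ℝ) * γ)) *
    Ξ.ballNorm p x₀ r (Ξ.netTau Ψ f j)

end DiffusionSystem

/-- The low-pass filters `h`. -/
structure IsLowPassFilter (h : ℝ → ℝ) : Prop where
  contDiff : ContDiff ℝ ((⊤ : ℕ∞) : WithTop ℕ∞) h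
  even : ∀ t, h (-t) = h t
  mem_Icc : ∀ t, h t ∈ Set.Icc (0 : ℝ) 1
  antitoneOn : AntitoneOn h (Set.Ici 0)
  eq_one : ∀ t, |t| ≤ 1 / 2 → h t = 1
  eq_zero : ∀ t, 1 ≤ t → h t = 0

end

/-! The analytic core is localization of `Φ_N`. Since `h` vanishes beyond 1 and is constant near 0,
`h(s) = e^{-s²} H(e^{-s²})` with `H` smooth. Truncating the Chebyshev expansion of `H` at degree `m`
leaves an error `O(m^{-S})` and coefficients of total size `O(3^m)`. Applied to the spectrum, the
polynomial part becomes a combination of heat kernels at times `(j+1)/N²`, `j ≤ m`, each with a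
Gaussian bound. For `m` a small multiple of `N ρ(x,y)` (with `ρ` capped at 1) the Gaussians beat
`3^m`, and the truncation error is `O(N^q (Nρ)^{-S})` for every `S` (`HeatBound.kernelΦ_decay`).

With the volume bound and essential compactness, this makes the `L¹` norms of `Φ_n(x,·)` bounded,
and fast decreasing away from the diagonal. By the Schur test the operators `σ(Φ_n)` are bounded on
every `L^p` and local up to negligible errors, and `Ψ_n` may replace `Φ_n` at negligible cost. As
`σ(Φ_n)` reproduces `Π_{n/2}`, it is near-best, so `σ(Ψ_{2^n}; f) → f` for `f ∈ X^p`.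

Part (a) is then telescoping with geometric weights. For (b), multiply `σ(Φ_n; f)` by a polynomial
close to the smooth factor `ψ`; the product assumption puts the result in `Π_{A n} φ_0` up to a
negligible error. For (c), write `f = ψ f + (1 - ψ) f` with a smooth cutoff `ψ`: the first term is
globally smooth, and the second is far from the smaller ball, so localization applies. -/

noncomputable section

/-! ### Polynomial approximation of smooth functions with controlled coefficients -/

open scoped ContDiff in
theorem fourierCoeffOn_decay (S : ℕ) : ∀ g : ℝ → ℂ, ContDiff ℝ ∞ g → Function.Periodic g 1 →
    ∃ C : ℝ, 0 ≤ C ∧ ∀ n : ℤ, ‖fourierCoeffOn zero_lt_one g n‖ * |(n : ℝ)| ^ S ≤ C := by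
  induction S with
  | zero =>
    intro g hg _
    obtain ⟨C, hC⟩ := (isCompact_Icc (a := (0 : ℝ)) (b := 1)).exists_bound_of_continuousOn
      hg.continuous.continuousOn
    refine ⟨C, (norm_nonneg _).trans (hC 0 (by simp)), fun n => ?_⟩
    rw [fourierCoeffOn_eq_integral]
    have : ‖∫ x in (0 : ℝ)..1, fourier (-n) (x : AddCircle ((1 : ℝ) - 0)) • g x‖ ≤
        C * |(1 : ℝ) - 0| := by
      refine intervalIntegral.norm_integral_le_of_norm_le_const fun x hx => ?_
      rw [Set.uIoc_of_le zero_le_one] at hx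
      have : Fact ((0 : ℝ) < 1 - 0) := ⟨by norm_num⟩
      have h1 : ‖fourier (-n) (x : AddCircle ((1 : ℝ) - 0))‖ ≤ 1 :=
        ((fourier (-n)).norm_coe_le_norm _).trans (fourier_norm _).le
      rw [norm_smul]
      calc _ ≤ 1 * ‖g x‖ := by gcongr
        _ ≤ C := by rw [one_mul]; exact hC x ⟨hx.1.le, hx.2⟩
    simpa using this
  | succ S ih =>
    intro g hg hp
    have hd : ContDiff ℝ ∞ (deriv g) := (contDiff_infty_iff_deriv.1 hg).2
    have hdiff : Differentiable ℝ g := (contDiff_infty_iff_deriv.1 hg).1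
    have hpd : Function.Periodic (deriv g) 1 := fun x => by
      rw [← deriv_comp_add_const]
      congr 1
      funext y
      exact hp y
    obtain ⟨C, hC0, hC⟩ := ih _ hd hpd
    refine ⟨C, hC0, fun n => ?_⟩
    rcases eq_or_ne n 0 with rfl | hn
    · simpa using hC0
    -- Integration by parts: periodicity removes the boundary term, and the factor `1/(2πn)` pays
    -- for one more power of `|n|`.
    have hg10 : g 1 = g 0 := by simpa using hp 0
    rw [fourierCoeffOn_of_hasDerivAt zero_lt_one hn (fun x _ => (hdiff x).hasDerivAt)
      (hd.continuous.intervalIntegrable _ _), hg10]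
    simp only [sub_self, mul_zero, zero_sub, norm_mul, norm_neg, norm_div, norm_one,
      Complex.ofReal_one, Complex.ofReal_zero, sub_zero, one_mul, Complex.norm_I, mul_one,
      Complex.norm_intCast, Complex.norm_real, Complex.norm_ofNat, Real.norm_eq_abs,
      abs_of_pos Real.pi_pos]
    have hn' : 0 < |(n : ℝ)| := by positivity
    have hpi : (1 : ℝ) ≤ 2 * Real.pi := by linarith [Real.pi_gt_three]
    calc _ = (‖fourierCoeffOn zero_lt_one (deriv g) n‖ * |(n : ℝ)| ^ S) / (2 * Real.pi) := by
          field_simp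
          ring
      _ ≤ C / 1 := by gcongr; exact hC n
      _ = C := div_one C

/-- The recurrence `T_{n+2} = 2X T_{n+1} - T_n` gives `s_{n+2} ≤ 2 s_{n+1} + s_n` for the
coefficient sums. Some geometric rate is all that is needed: a Gaussian factor absorbs it later. -/
theorem Polynomial.Chebyshev.sum_abs_coeff_T_le (n M : ℕ) :
    ∑ i ∈ Finset.range M, |(Polynomial.Chebyshev.T ℝ n).coeff i| ≤ 3 ^ n := by
  have hX : ∀ (p : Polynomial ℝ) (M : ℕ), ∑ i ∈ Finset.range M, |(Polynomial.X * p).coeff i| ≤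
      ∑ i ∈ Finset.range M, |p.coeff i| := fun p M => by
    cases M with
    | zero => simp
    | succ M =>
      rw [Finset.sum_range_succ', Finset.sum_range_succ]
      simp
  induction n using Nat.twoStepInduction generalizing M with
  | zero =>
    simp only [Nat.cast_zero, Polynomial.Chebyshev.T_zero, Polynomial.coeff_one, pow_zero]
    calc _ ≤ ∑ i ∈ Finset.range M, if 0 = i then (1 : ℝ) else 0 :=
          Finset.sum_le_sum fun i _ => by split_ifs <;> grind
      _ ≤ 1 := by rw [Finset.sum_ite_eq]; split_ifs <;> norm_num
  | one =>
    have h1 : ∑ i ∈ Finset.range M, |(Polynomial.X : Polynomial ℝ).coeff i| ≤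
        ∑ i ∈ Finset.range M, if 1 = i then (1 : ℝ) else 0 :=
      Finset.sum_le_sum fun i _ => by rw [Polynomial.coeff_X]; split_ifs <;> simp
    rw [Finset.sum_ite_eq] at h1
    simp only [Nat.cast_one, Polynomial.Chebyshev.T_one, pow_one]
    split_ifs at h1 <;> linarith
  | more n ih0 ih1 =>
    have e : Polynomial.Chebyshev.T ℝ ((n + 2 : ℕ) : ℤ) =
        2 * (Polynomial.X * Polynomial.Chebyshev.T ℝ ((n + 1 : ℕ) : ℤ)) -
          Polynomial.Chebyshev.T ℝ (n : ℤ) := by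
      push_cast
      rw [Polynomial.Chebyshev.T_add_two, mul_assoc]
    have e2 : ∀ p : Polynomial ℝ, ∀ i, ((2 : Polynomial ℝ) * p).coeff i = 2 * p.coeff i := by
      intro p i
      rw [two_mul, Polynomial.coeff_add, two_mul]
    calc _ ≤ ∑ i ∈ Finset.range M,
          (2 * |(Polynomial.X * Polynomial.Chebyshev.T ℝ ((n + 1 : ℕ) : ℤ)).coeff i| +
            |(Polynomial.Chebyshev.T ℝ (n : ℤ)).coeff i|) := by
          refine Finset.sum_le_sum fun i _ => ?_
          rw [e, Polynomial.coeff_sub, e2]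
          refine (abs_sub _ _).trans ?_
          rw [abs_mul, abs_two]
      _ ≤ 2 * 3 ^ (n + 1) + 3 ^ n := by
          rw [Finset.sum_add_distrib, ← Finset.mul_sum]
          gcongr
          · exact (hX _ _).trans (ih1 M)
          · exact ih0 M
      _ ≤ 3 ^ (n + 2) := by
          have : (0 : ℝ) < 3 ^ n := by positivity
          rw [pow_add, pow_add]
          linarith

open scoped ContDiff in
/-- Cosine expansion of a smooth function of `cos θ`, with rapidly decaying coefficients. -/
theorem exists_hasSum_cos (H : ℝ → ℝ) (hH : ContDiff ℝ ∞ H) :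
    ∃ c : ℤ → ℝ, (∀ S : ℕ, ∃ C : ℝ, 0 ≤ C ∧ ∀ n : ℤ, |c n| * |(n : ℝ)| ^ S ≤ C) ∧
      ∀ θ : ℝ, HasSum (fun n : ℤ => c n * Real.cos (n * θ)) (H (Real.cos θ)) := by
  -- Composition with the cosine makes `H` on `[-1, 1]` a smooth periodic function, so the endpoints
  -- cause no trouble.
  set g : ℝ → ℂ := fun θ => (H (Real.cos (2 * Real.pi * θ)) : ℂ) with hg
  have hgs : ContDiff ℝ ∞ g := Complex.ofRealCLM.contDiff.comp
    (hH.comp (Real.contDiff_cos.comp (contDiff_const.mul contDiff_id)))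
  have hgp : Function.Periodic g 1 := fun x => by simp [hg, mul_add]
  have : Fact ((0 : ℝ) < 1) := ⟨one_pos⟩
  let G : C(AddCircle (1 : ℝ), ℂ) := ⟨hgp.lift, continuous_coinduced_dom.mpr hgs.continuous⟩
  have hGc : ∀ n, fourierCoeff G n = fourierCoeffOn zero_lt_one g n := fun n => by
    rw [fourierCoeff_eq_intervalIntegral _ _ 0, fourierCoeffOn_eq_integral]
    simp only [zero_add, sub_zero, fourier_coe_apply]
    rfl
  have hdecay : ∀ S : ℕ, ∃ C : ℝ, 0 ≤ C ∧ ∀ n : ℤ, ‖fourierCoeff G n‖ * |(n : ℝ)| ^ S ≤ C := by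
    intro S
    simp_rw [hGc]
    exact fourierCoeffOn_decay S g hgs hgp
  have hsum : Summable (fourierCoeff G) := by
    obtain ⟨C, hC0, hC⟩ := hdecay 2
    have h2 : Summable fun n : ℤ => C * (1 / (n : ℝ) ^ 2) :=
      (Real.summable_one_div_int_pow.2 one_lt_two).mul_left C
    refine Summable.of_norm_bounded_eventually h2 ?_
    filter_upwards [(Set.finite_singleton (0 : ℤ)).compl_mem_cofinite] with n hn
    have hn : (n : ℝ) ≠ 0 := by exact_mod_cast hn
    have h3 := hC n
    rw [sq_abs] at h3
    rw [mul_one_div, le_div_iff₀ (by positivity)]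
    exact h3
  refine ⟨fun n => (fourierCoeff G n).re, fun S => ?_, fun θ => ?_⟩
  · obtain ⟨C, hC0, hC⟩ := hdecay S
    refine ⟨C, hC0, fun n => le_trans ?_ (hC n)⟩
    gcongr
    exact Complex.abs_re_le_norm _
  · have key : ∀ t : ℝ, HasSum
        (fun n : ℤ => fourierCoeff G n • Complex.exp (2 * Real.pi * Complex.I * n * t)) (g t) := by
      intro t
      have := has_pointwise_sum_fourier_series_of_summable hsum (t : AddCircle (1 : ℝ))
      simpa [fourier_coe_apply] using! this
    -- Averaging the series at `±θ/(2π)`, where `g` takes the same value, turns exponentials into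
    -- cosines.
    have h1 := key (θ / (2 * Real.pi))
    have h2 := key (-(θ / (2 * Real.pi)))
    have hpi : (2 * Real.pi : ℝ) ≠ 0 := by positivity
    have e1 : g (θ / (2 * Real.pi)) = (H (Real.cos θ) : ℂ) := by
      simp only [hg]; rw [mul_div_cancel₀ _ hpi]
    have e2 : g (-(θ / (2 * Real.pi))) = (H (Real.cos θ) : ℂ) := by
      simp only [hg]; rw [mul_neg, mul_div_cancel₀ _ hpi, Real.cos_neg]
    rw [e1] at h1
    rw [e2] at h2
    have h3 := (h1.add h2).div_const 2
    have h4 := Complex.reCLM.hasSum h3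
    convert! h4 using 1
    · funext n
      have hz : (2 * Real.pi * Complex.I * n * ((θ / (2 * Real.pi) : ℝ) : ℂ)) =
          ((n * θ : ℝ) : ℂ) * Complex.I := by
        have : (Real.pi : ℂ) ≠ 0 := by exact_mod_cast Real.pi_ne_zero
        push_cast
        field_simp
      have hz' : (2 * Real.pi * Complex.I * n * ((-(θ / (2 * Real.pi)) : ℝ) : ℂ)) =
          -((n * θ : ℝ) : ℂ) * Complex.I := by
        have : (Real.pi : ℂ) ≠ 0 := by exact_mod_cast Real.pi_ne_zero
        push_cast
        field_simp
      simp only [hz, hz', smul_eq_mul, ← mul_add, mul_div_assoc]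
      rw [← Complex.cos, ← Complex.ofReal_cos, mul_comm (fourierCoeff _ _), Complex.reCLM_apply,
        Complex.re_ofReal_mul, mul_comm]
    · simp

open scoped ContDiff in
/-- A Jackson type theorem for smooth functions, with control of the coefficients. -/
theorem exists_polynomial_approx (H : ℝ → ℝ) (hH : ContDiff ℝ ∞ H) (S : ℕ) :
    ∃ C : ℝ, 0 ≤ C ∧ ∀ m : ℕ, 1 ≤ m → ∃ P : Polynomial ℝ, P.natDegree ≤ m ∧
      ∑ i ∈ Finset.range (m + 1), |P.coeff i| ≤ C * 3 ^ m ∧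
      ∀ u ∈ Set.Icc (-1 : ℝ) 1, |H u - P.eval u| * (m : ℝ) ^ S ≤ C := by
  obtain ⟨c, hc, hsum⟩ := exists_hasSum_cos H hH
  obtain ⟨C0, hC0, hc0⟩ := hc 0
  -- Two powers beyond `S` make the tail of the series summable.
  obtain ⟨C2, hC2, hc2⟩ := hc (S + 2)
  -- Folding the two-sided series onto `ℕ` counts `c 0` twice; the approximating polynomial
  -- subtracts it once.
  set b : ℕ → ℝ := fun n => c n + c (-n) with hb
  have hb0 : ∀ n, |b n| ≤ 2 * C0 := fun n => by
    have h1 := hc0 n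
    have h2 := hc0 (-n)
    simp only [pow_zero, mul_one] at h1 h2
    exact (abs_add_le _ _).trans (by linarith)
  have hb2 : ∀ n : ℕ, |b n| * (n : ℝ) ^ (S + 2) ≤ 2 * C2 := fun n => by
    have h1 := hc2 n
    have h2 := hc2 (-n)
    simp only [Int.cast_neg, abs_neg, Int.cast_natCast, Nat.abs_cast] at h1 h2
    calc _ ≤ (|c n| + |c (-n)|) * (n : ℝ) ^ (S + 2) := by
          gcongr; exact abs_add_le _ _
      _ ≤ _ := by rw [add_mul]; linarith
  have hs2 : Summable fun i : ℕ => 2 * C2 * (1 / ((i : ℝ) + 1) ^ 2) := by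
    have := (summable_nat_add_iff 1).2 (Real.summable_one_div_nat_pow.2 one_lt_two)
    simpa using this.mul_left (2 * C2)
  set D := ∑' i : ℕ, 2 * C2 * (1 / ((i : ℝ) + 1) ^ 2) with hD
  have hD0 : 0 ≤ D := tsum_nonneg fun i => by positivity
  have hbsum : ∀ θ : ℝ, HasSum (fun n : ℕ => b n * Real.cos (n * θ)) (H (Real.cos θ) + c 0) := by
    intro θ
    have := (hsum θ).nat_add_neg
    convert! this using 1
    · funext n
      simp [hb, add_mul]
    · simp
  refine ⟨3 * C0 + D + 2 * C0, by positivity, fun m hm => ?_⟩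
  refine ⟨∑ n ∈ Finset.range (m + 1), Polynomial.C (b n) * Polynomial.Chebyshev.T ℝ n -
    Polynomial.C (c 0), ?_, ?_, ?_⟩
  · refine (Polynomial.natDegree_sub_le _ _).trans (max_le ?_ (by simp))
    refine Polynomial.natDegree_sum_le_of_forall_le _ _ fun n hn => ?_
    refine (Polynomial.natDegree_C_mul_le _ _).trans ?_
    rw [Polynomial.Chebyshev.natDegree_T]
    simp only [Finset.mem_range] at hn
    simpa using by omega
  · have h3 : ∑ n ∈ Finset.range (m + 1), (3 : ℝ) ^ n ≤ 3 / 2 * 3 ^ m := by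
      rw [geom_sum_eq (by norm_num), pow_succ]
      have : (0 : ℝ) < 3 ^ m := by positivity
      linarith
    calc _ ≤ ∑ i ∈ Finset.range (m + 1), (∑ n ∈ Finset.range (m + 1),
            (|b n| * |(Polynomial.Chebyshev.T ℝ n).coeff i|) + |(Polynomial.C (c 0)).coeff i|) := by
          refine Finset.sum_le_sum fun i _ => ?_
          rw [Polynomial.coeff_sub, Polynomial.finsetSum_coeff]
          refine (abs_sub _ _).trans ?_
          gcongr
          refine (Finset.abs_sum_le_sum_abs _ _).trans (Finset.sum_le_sum fun n _ => ?_)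
          rw [Polynomial.coeff_C_mul, abs_mul]
      _ = ∑ n ∈ Finset.range (m + 1), |b n| *
            ∑ i ∈ Finset.range (m + 1), |(Polynomial.Chebyshev.T ℝ n).coeff i| + |c 0| := by
          rw [Finset.sum_add_distrib, Finset.sum_comm]
          simp_rw [Finset.mul_sum]
          congr 1
          rw [Finset.sum_range_succ']
          simp
      _ ≤ ∑ n ∈ Finset.range (m + 1), 2 * C0 * 3 ^ n + C0 := by
          gcongr with n _
          · exact hb0 n
          · exact Polynomial.Chebyshev.sum_abs_coeff_T_le n _
          · simpa using hc0 0
      _ ≤ 2 * C0 * (3 / 2 * 3 ^ m) + 2 * C0 * 3 ^ m := by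
          rw [← Finset.mul_sum]
          gcongr
          have : (1 : ℝ) ≤ 3 ^ m := one_le_pow₀ (by norm_num)
          nlinarith
      _ ≤ _ := by
          have : (0 : ℝ) ≤ 3 ^ m := by positivity
          nlinarith [mul_nonneg hD0 this]
  · intro u hu
    obtain ⟨θ, rfl⟩ : ∃ θ, Real.cos θ = u := ⟨Real.arccos u, Real.cos_arccos hu.1 hu.2⟩
    have hev : (∑ n ∈ Finset.range (m + 1), Polynomial.C (b n) * Polynomial.Chebyshev.T ℝ n -
        Polynomial.C (c 0)).eval (Real.cos θ) =
        ∑ n ∈ Finset.range (m + 1), b n * Real.cos (n * θ) - c 0 := by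
      rw [Polynomial.eval_sub, Polynomial.eval_finsetSum, Polynomial.eval_C]
      congr 1
      refine Finset.sum_congr rfl fun n _ => ?_
      rw [Polynomial.eval_C_mul, Polynomial.Chebyshev.T_real_cos]
      simp
    have hs := hbsum θ
    have htail := hs.summable.sum_add_tsum_nat_add (m + 1)
    rw [hs.tsum_eq] at htail
    rw [hev, show H (Real.cos θ) - (∑ n ∈ Finset.range (m + 1), b n * Real.cos (n * θ) - c 0) =
      ∑' i : ℕ, b (i + (m + 1)) * Real.cos ((i + (m + 1) : ℕ) * θ) by linarith]
    have hterm : ∀ i : ℕ, ‖b (i + (m + 1)) * Real.cos ((i + (m + 1) : ℕ) * θ) * (m : ℝ) ^ S‖ ≤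
        2 * C2 * (1 / ((i : ℝ) + 1) ^ 2) := by
      intro i
      have h1 := hb2 (i + (m + 1))
      rw [norm_mul, norm_mul, Real.norm_eq_abs, Real.norm_eq_abs, mul_one_div,
        le_div_iff₀ (by positivity), Real.norm_of_nonneg (by positivity)]
      calc _ ≤ |b (i + (m + 1))| * 1 * ((i + (m + 1) : ℕ) : ℝ) ^ S *
            ((i + (m + 1) : ℕ) : ℝ) ^ 2 := by
            gcongr
            · exact Real.abs_cos_le_one _
            · omega
            · push_cast; linarith [(Nat.cast_nonneg m : (0 : ℝ) ≤ m)]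
        _ = |b (i + (m + 1))| * ((i + (m + 1) : ℕ) : ℝ) ^ (S + 2) := by ring
        _ ≤ _ := h1
    rw [← abs_of_nonneg (show (0 : ℝ) ≤ (m : ℝ) ^ S by positivity), ← abs_mul, ← tsum_mul_right,
      ← Real.norm_eq_abs]
    refine (tsum_of_norm_bounded hs2.hasSum hterm).trans ?_
    linarith

open scoped ContDiff in
/-- A low-pass filter, as a function of the Gaussian, is the Gaussian times a smooth function. -/
theorem IsLowPassFilter.exists_smooth_factor {h : ℝ → ℝ} (hh : IsLowPassFilter h) :
    ∃ H : ℝ → ℝ, ContDiff ℝ ∞ H ∧ ∀ s : ℝ, 0 ≤ s →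
      h s = Real.exp (-s ^ 2) * H (Real.exp (-s ^ 2)) := by
  -- Here `u = e^{-s²}`, that is `s = √(-log u)`. The substitution is singular at `u = 0` and `u =
  -- 1`, but `h` vanishes for `u ≤ e^{-1}` and is 1 near `u = 1`. Dividing by `u` leaves a spare
  -- factor `e^{-s²}` that later makes the remainder series converge.
  set H : ℝ → ℝ := fun u => if u ≤ Real.exp (-1) then 0 else h (√(-Real.log u)) / u with hH
  have hform : ∀ u, 0 < u → H u = h (√(-Real.log u)) / u := fun u hu => by
    simp only [hH]
    split_ifs with h1
    · have h2 : 1 ≤ -Real.log u := by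
        have := Real.log_le_log hu h1
        rw [Real.log_exp] at this
        linarith
      rw [hh.eq_zero _ (Real.one_le_sqrt.2 h2), zero_div]
    · rfl
  refine ⟨H, contDiff_iff_contDiffAt.2 fun u => ?_, fun s hs => ?_⟩
  · rcases lt_or_ge u (Real.exp (-1)) with h1 | h1
    · have : H =ᶠ[𝓝 u] fun _ => 0 := by
        filter_upwards [eventually_lt_nhds h1] with v hv
        simp [hH, hv.le]
      exact contDiffAt_const.congr_of_eventuallyEq this
    have hu : 0 < u := (Real.exp_pos _).trans_le h1
    rcases lt_or_ge u 1 with h2 | h2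
    · have : H =ᶠ[𝓝 u] fun v => h (√(-Real.log v)) / v := by
        filter_upwards [eventually_gt_nhds hu] with v hv
        exact hform v hv
      refine ContDiffAt.congr_of_eventuallyEq ?_ this
      have hl : -Real.log u ≠ 0 := by
        have := Real.log_neg hu h2
        linarith
      refine ContDiffAt.div ?_ contDiffAt_id hu.ne'
      exact hh.contDiff.contDiffAt.comp u
        (((Real.contDiffAt_log.2 hu.ne').neg).sqrt hl)
    -- Beyond `e^{-1/4}` the argument of `h` is at most 1/2; for `u > 1` the default value 0 of the
    -- root of a negative number fits too.
    · have h3 : Real.exp (-(1 / 4)) < u := lt_of_lt_of_le (by simp) h2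
      have : H =ᶠ[𝓝 u] fun v => v⁻¹ := by
        filter_upwards [eventually_gt_nhds h3] with v hv
        have hv0 : 0 < v := (Real.exp_pos _).trans hv
        rw [hform v hv0, hh.eq_one, one_div]
        have h4 := Real.log_lt_log (Real.exp_pos _) hv
        rw [Real.log_exp] at h4
        rw [abs_of_nonneg (Real.sqrt_nonneg _)]
        refine Real.sqrt_le_iff.2 ⟨by norm_num, by linarith⟩
      exact (contDiffAt_inv ℝ hu.ne').congr_of_eventuallyEq this
  · rw [hform _ (Real.exp_pos _), Real.log_exp, neg_neg, Real.sqrt_sq hs]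
    field_simp

/-! ### Localization of the kernels from the Gaussian bound -/

namespace DiffusionSystem

variable {X : Type*} [MetricSpace X] [MeasurableSpace X] [BorelSpace X] (Ξ : DiffusionSystem X)

theorem lam_nonneg (k : ℕ) : 0 ≤ Ξ.lam k := Ξ.lam_zero ▸ Ξ.lam_monotone (Nat.zero_le k)

theorem finite_lam_lt (n : ℝ) : {k | Ξ.lam k < n}.Finite := by
  obtain ⟨N, hN⟩ := eventually_atTop.1 (Ξ.lam_tendsto.eventually_ge_atTop n)
  refine (Set.finite_lt_nat N).subset fun k hk => ?_
  by_contra hc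
  exact absurd (hN k (not_lt.1 hc)) (not_le.2 hk)

/-- The indices `k` with `λ_k < n`. -/
def idx (n : ℝ) : Finset ℕ := (Ξ.finite_lam_lt n).toFinset

@[simp] theorem mem_idx {n : ℝ} {k : ℕ} : k ∈ Ξ.idx n ↔ Ξ.lam k < n := by simp [idx]

theorem christoffel_eq_sum (n : ℝ) (x : X) :
    Ξ.christoffel n x = ∑ k ∈ Ξ.idx n, Ξ.φ k x ^ 2 := by
  rw [christoffel, tsum_eq_sum (s := Ξ.idx n)]
  · exact Finset.sum_congr rfl fun k hk => if_pos (Ξ.mem_idx.1 hk)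
  · exact fun k hk => if_neg fun hc => hk (Ξ.mem_idx.2 hc)

theorem christoffel_nonneg (n : ℝ) (x : X) : 0 ≤ Ξ.christoffel n x := by
  rw [christoffel_eq_sum]
  positivity

theorem kernelΦ_support {h : ℝ → ℝ} (hh : IsLowPassFilter h) {N : ℝ} (hN : 0 < N) (x y : X)
    (k : ℕ) (hk : k ∉ Ξ.idx N) : h (Ξ.lam k / N) * Ξ.φ k x * Ξ.φ k y = 0 := by
  rw [mem_idx, not_lt] at hk
  rw [hh.eq_zero _ ((one_le_div hN).2 hk), zero_mul, zero_mul]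

theorem kernelΦ_eq_sum {h : ℝ → ℝ} (hh : IsLowPassFilter h) {N : ℝ} (hN : 0 < N) (x y : X) :
    Ξ.kernelΦ h N x y = ∑ k ∈ Ξ.idx N, h (Ξ.lam k / N) * Ξ.φ k x * Ξ.φ k y :=
  tsum_eq_sum fun k hk => Ξ.kernelΦ_support hh hN x y k hk

theorem kernelΦ_comm (h : ℝ → ℝ) (N : ℝ) (x y : X) : Ξ.kernelΦ h N x y = Ξ.kernelΦ h N y x := by
  simp only [kernelΦ]
  congr 1
  funext k
  ring

theorem abs_kernelΦ_le {h : ℝ → ℝ} (hh : IsLowPassFilter h) {N : ℝ} (hN : 0 < N) (x y : X) :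
    |Ξ.kernelΦ h N x y| ≤ √(Ξ.christoffel N x) * √(Ξ.christoffel N y) := by
  rw [Ξ.kernelΦ_eq_sum hh hN, christoffel_eq_sum, christoffel_eq_sum]
  calc _ ≤ ∑ k ∈ Ξ.idx N, |Ξ.φ k x| * |Ξ.φ k y| := by
        refine (Finset.abs_sum_le_sum_abs _ _).trans (Finset.sum_le_sum fun k _ => ?_)
        rw [abs_mul, abs_mul, mul_assoc]
        refine mul_le_of_le_one_left (by positivity) ?_
        have := hh.mem_Icc (Ξ.lam k / N)
        exact abs_le.2 ⟨by linarith [this.1], this.2⟩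
    _ ≤ √(∑ k ∈ Ξ.idx N, |Ξ.φ k x| ^ 2) * √(∑ k ∈ Ξ.idx N, |Ξ.φ k y| ^ 2) :=
        Real.sum_mul_le_sqrt_mul_sqrt _ _ _
    _ = _ := by simp only [sq_abs]

/-- The Gaussian upper bound for the heat kernel. -/
structure HeatBound (q κ₁ κ₂ : ℝ) : Prop where
  q_ge : 1 ≤ q
  pos₁ : 0 < κ₁
  pos₂ : 0 < κ₂
  summable : ∀ (x y : X) (t : ℝ), 0 < t → t ≤ 1 →
    Summable (fun k : ℕ => Real.exp (-(Ξ.lam k ^ 2 * t)) * Ξ.φ k x * Ξ.φ k y)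
  bound : ∀ (x y : X) (t : ℝ), 0 < t → t ≤ 1 →
    |∑' k : ℕ, Real.exp (-(Ξ.lam k ^ 2 * t)) * Ξ.φ k x * Ξ.φ k y| ≤
      κ₁ * t ^ (-q / 2) * Real.exp (-(κ₂ * (dist x y ^ 2 / t)))

variable {Ξ} {q κ₁ κ₂ : ℝ}

theorem inv_sq_rpow {N : ℝ} (hN : 0 < N) (q : ℝ) : (1 / N ^ 2) ^ (-q / 2) = N ^ q := by
  rw [one_div, ← Real.rpow_natCast, ← Real.rpow_neg hN.le, ← Real.rpow_mul hN.le]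
  congr 1
  push_cast
  ring

theorem HeatBound.diag (hb : Ξ.HeatBound q κ₁ κ₂) (x : X) {N : ℝ} (hN : 1 ≤ N) :
    ∑' k : ℕ, Real.exp (-(Ξ.lam k ^ 2 * (1 / N ^ 2))) * Ξ.φ k x * Ξ.φ k x ≤ κ₁ * N ^ q := by
  have hN0 : 0 < N := by linarith
  have h1 := (le_abs_self _).trans (hb.bound x x (1 / N ^ 2) (by positivity)
    ((div_le_one (by positivity)).2 (one_le_pow₀ hN)))
  rw [inv_sq_rpow hN0] at h1
  simpa using h1

/-- For `λ_k < N` the heat factor at time `N⁻²` is at least `e⁻¹ > 1/3`, so the diagonal heat kernel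
dominates. -/
theorem HeatBound.christoffel_le (hb : Ξ.HeatBound q κ₁ κ₂) (x : X) {N : ℝ} (hN : 1 ≤ N) :
    Ξ.christoffel N x ≤ 3 * κ₁ * N ^ q := by
  have hN0 : 0 < N := by linarith
  have hs := hb.summable x x (1 / N ^ 2) (by positivity)
    ((div_le_one (by positivity)).2 (one_le_pow₀ hN))
  have hnn : ∀ k, 0 ≤ Real.exp (-(Ξ.lam k ^ 2 * (1 / N ^ 2))) * Ξ.φ k x * Ξ.φ k x := fun k => by
    rw [mul_assoc]
    exact mul_nonneg (Real.exp_pos _).le (mul_self_nonneg _)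
  have h1 := (hs.sum_le_tsum (Ξ.idx N) fun k _ => hnn k).trans (hb.diag x hN)
  rw [christoffel_eq_sum, mul_assoc]
  refine le_trans ?_ (mul_le_mul_of_nonneg_left h1 (by norm_num))
  rw [Finset.mul_sum]
  refine Finset.sum_le_sum fun k hk => ?_
  rw [mem_idx] at hk
  have h2 : Ξ.lam k ^ 2 * (1 / N ^ 2) ≤ 1 := by
    rw [mul_one_div]
    refine (div_le_one (by positivity)).2 ?_
    have := Ξ.lam_nonneg k
    gcongr
  have h3 : Real.exp (-1) ≤ Real.exp (-(Ξ.lam k ^ 2 * (1 / N ^ 2))) :=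
    Real.exp_le_exp.2 (by linarith)
  have h4 : 1 ≤ 3 * Real.exp (-1) := by
    rw [Real.exp_neg, ← div_eq_mul_inv, one_le_div (Real.exp_pos _)]
    linarith [Real.exp_one_lt_d9]
  have h5 : 1 ≤ 3 * Real.exp (-(Ξ.lam k ^ 2 * (1 / N ^ 2))) := by linarith
  calc _ = 1 * (Ξ.φ k x * Ξ.φ k x) := by ring
    _ ≤ 3 * Real.exp (-(Ξ.lam k ^ 2 * (1 / N ^ 2))) * (Ξ.φ k x * Ξ.φ k x) := by
        gcongr
        exact mul_self_nonneg _
    _ = _ := by ring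

/-- The kernel of a function of the heat operator that is a polynomial plus a small error. -/
theorem HeatBound.abs_kernelΦ_le_of_approx (hb : Ξ.HeatBound q κ₁ κ₂) {h H : ℝ → ℝ}
    (hH : ∀ s : ℝ, 0 ≤ s → h s = Real.exp (-s ^ 2) * H (Real.exp (-s ^ 2)))
    {N : ℝ} (hN : 1 ≤ N) {m : ℕ} (hm : ((m : ℝ) + 1) ≤ N ^ 2) {P : Polynomial ℝ}
    (hP : P.natDegree ≤ m) {A B : ℝ} (hA : ∑ i ∈ Finset.range (m + 1), |P.coeff i| ≤ A)
    (hB : ∀ u ∈ Set.Icc (-1 : ℝ) 1, |H u - P.eval u| ≤ B) (x y : X) :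
    |Ξ.kernelΦ h N x y| ≤
      A * (κ₁ * N ^ q * Real.exp (-(κ₂ * dist x y ^ 2 * N ^ 2 / (m + 1)))) + B * (κ₁ * N ^ q) := by
  have hN0 : 0 < N := by linarith
  have h1 := hb.pos₁
  have h2 := hb.pos₂
  set t : ℝ := 1 / N ^ 2 with ht
  have ht0 : 0 < t := by positivity
  have ht1 : t ≤ 1 := (div_le_one (by positivity)).2 (one_le_pow₀ hN)
  set u : ℕ → ℝ := fun k => Real.exp (-(Ξ.lam k ^ 2 * t)) with hu
  have hu0 : ∀ k, 0 < u k := fun k => Real.exp_pos _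
  have hu1 : ∀ k, u k ≤ 1 := fun k => by
    rw [hu, Real.exp_le_one_iff, neg_nonpos]
    positivity
  have hB0 : 0 ≤ B := (abs_nonneg _).trans (hB 0 (by simp))
  -- The power `u^{j+1}` is the heat factor at time `(j+1)t`; `hm` keeps these times in the range of
  -- the Gaussian bound.
  have hjt : ∀ j ∈ Finset.range (m + 1), 0 < ((j : ℝ) + 1) * t ∧ ((j : ℝ) + 1) * t ≤ 1 := by
    intro j hj
    refine ⟨by positivity, ?_⟩
    rw [ht, mul_one_div]
    refine (div_le_one (by positivity)).2 (le_trans ?_ hm)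
    have : (j : ℝ) ≤ m := by exact_mod_cast Nat.lt_succ_iff.1 (Finset.mem_range.1 hj)
    linarith
  have hpow : ∀ (j k : ℕ), u k ^ (j + 1) = Real.exp (-(Ξ.lam k ^ 2 * (((j : ℝ) + 1) * t))) := by
    intro j k
    rw [hu, ← Real.exp_nat_mul]
    congr 1
    push_cast
    ring
  have hmain : HasSum (fun k => ∑ j ∈ Finset.range (m + 1),
      P.coeff j * (Real.exp (-(Ξ.lam k ^ 2 * (((j : ℝ) + 1) * t))) * Ξ.φ k x * Ξ.φ k y))
      (∑ j ∈ Finset.range (m + 1), P.coeff j *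
        ∑' k, Real.exp (-(Ξ.lam k ^ 2 * (((j : ℝ) + 1) * t))) * Ξ.φ k x * Ξ.φ k y) :=
    hasSum_sum fun j hj => (hb.summable x y _ (hjt j hj).1 (hjt j hj).2).hasSum.mul_left _
  have hdiag : ∀ z : X, Summable fun k => u k * Ξ.φ k z * Ξ.φ k z := fun z =>
    hb.summable z z t ht0 ht1
  have hbd := ((hdiag x).add (hdiag y)).mul_left (B / 2)
  -- By `2|ab| ≤ a² + b²` the remainder is dominated by the diagonal heat kernels at `x` and `y`.
  have hR : ∀ k, ‖u k * (H (u k) - P.eval (u k)) * Ξ.φ k x * Ξ.φ k y‖ ≤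
      B / 2 * (u k * Ξ.φ k x * Ξ.φ k x + u k * Ξ.φ k y * Ξ.φ k y) := by
    intro k
    have h3 := hB (u k) ⟨by linarith [hu0 k], hu1 k⟩
    rw [norm_mul, norm_mul, norm_mul, Real.norm_of_nonneg (hu0 k).le, Real.norm_eq_abs,
      Real.norm_eq_abs, Real.norm_eq_abs]
    have h4 : |Ξ.φ k x| * |Ξ.φ k y| ≤ 1 / 2 * (Ξ.φ k x * Ξ.φ k x + Ξ.φ k y * Ξ.φ k y) := by
      nlinarith [sq_nonneg (|Ξ.φ k x| - |Ξ.φ k y|), sq_abs (Ξ.φ k x), sq_abs (Ξ.φ k y)]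
    calc _ = u k * |H (u k) - P.eval (u k)| * (|Ξ.φ k x| * |Ξ.φ k y|) := by ring
      _ ≤ u k * B * (1 / 2 * (Ξ.φ k x * Ξ.φ k x + Ξ.φ k y * Ξ.φ k y)) := by
          have := (hu0 k).le
          gcongr
      _ = _ := by ring
  have hRs := Summable.of_norm_bounded hbd hR
  have hRb := tsum_of_norm_bounded hbd.hasSum hR
  have hsplit : Ξ.kernelΦ h N x y = ∑ j ∈ Finset.range (m + 1), P.coeff j *
        ∑' k, Real.exp (-(Ξ.lam k ^ 2 * (((j : ℝ) + 1) * t))) * Ξ.φ k x * Ξ.φ k y +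
      ∑' k, u k * (H (u k) - P.eval (u k)) * Ξ.φ k x * Ξ.φ k y := by
    rw [← (hmain.add hRs.hasSum).tsum_eq, kernelΦ]
    congr 1
    funext k
    have e1 : -(Ξ.lam k / N) ^ 2 = -(Ξ.lam k ^ 2 * t) := by
      rw [ht, div_pow, mul_one_div]
    rw [hH _ (div_nonneg (Ξ.lam_nonneg k) hN0.le), e1, Polynomial.eval_eq_sum_range' (n := m + 1)
      (by omega)]
    simp_rw [← hpow]
    have e2 : ∑ j ∈ Finset.range (m + 1), P.coeff j * (u k ^ (j + 1) * Ξ.φ k x * Ξ.φ k y) =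
        u k * (∑ j ∈ Finset.range (m + 1), P.coeff j * u k ^ j) * Ξ.φ k x * Ξ.φ k y := by
      rw [Finset.mul_sum, Finset.sum_mul, Finset.sum_mul]
      exact Finset.sum_congr rfl fun j _ => by ring
    rw [e2]
    ring
  rw [hsplit]
  refine (abs_add_le _ _).trans (add_le_add ?_ ?_)
  · refine (Finset.abs_sum_le_sum_abs _ _).trans ?_
    refine le_trans ?_ (mul_le_mul_of_nonneg_right hA (by positivity))
    rw [Finset.sum_mul]
    refine Finset.sum_le_sum fun j hj => ?_
    rw [abs_mul]
    refine mul_le_mul_of_nonneg_left ((hb.bound x y _ (hjt j hj).1 (hjt j hj).2).trans ?_)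
      (abs_nonneg _)
    have hj1 : (j : ℝ) ≤ m := by exact_mod_cast Nat.lt_succ_iff.1 (Finset.mem_range.1 hj)
    -- All times lie between `t` and `(m+1)t`: the prefactor is largest at the former, the Gaussian
    -- weakest at the latter.
    have e3 : (((j : ℝ) + 1) * t) ^ (-q / 2) ≤ N ^ q := by
      rw [← inv_sq_rpow hN0, ← ht]
      refine Real.rpow_le_rpow_of_nonpos ht0 ?_ (by linarith [hb.q_ge])
      nlinarith [(Nat.cast_nonneg j : (0 : ℝ) ≤ j)]
    have e4 : κ₂ * dist x y ^ 2 * N ^ 2 / (m + 1) ≤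
        κ₂ * (dist x y ^ 2 / (((j : ℝ) + 1) * t)) := by
      rw [ht, mul_one_div, div_div_eq_mul_div, ← mul_div_assoc, ← mul_assoc]
      gcongr
    gcongr
  · rw [← Real.norm_eq_abs]
    refine hRb.trans ?_
    rw [tsum_mul_left, (hdiag x).tsum_add (hdiag y)]
    have d1 := hb.diag x hN
    have d2 := hb.diag y hN
    calc _ ≤ B / 2 * (κ₁ * N ^ q + κ₁ * N ^ q) := by gcongr
      _ = _ := by ring

/-- Localization of the kernels `Φ_N` (at distances up to `1`). -/
theorem HeatBound.kernelΦ_decay (hb : Ξ.HeatBound q κ₁ κ₂) {h : ℝ → ℝ}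
    (hh : IsLowPassFilter h) (S : ℕ) : ∃ C : ℝ, 0 ≤ C ∧ ∀ N : ℝ, 1 ≤ N → ∀ x y : X,
      |Ξ.kernelΦ h N x y| * (N * min (dist x y) 1) ^ S ≤ C * N ^ q := by
  obtain ⟨H, hHs, hH⟩ := hh.exists_smooth_factor
  obtain ⟨C, hC0, hC⟩ := exists_polynomial_approx H hHs S
  have h1 := hb.pos₁
  have h2 := hb.pos₂
  -- With `m + 1 ≤ ε v` the Gaussian exponent is at least `κ₂ v / ε ≥ 3v`; since `3^m ≤ e^{2m} ≤
  -- e^{2v}`, a factor `e^{-v}` survives.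
  set ε := min 1 (κ₂ / 3) with hε
  have hε0 : 0 < ε := by positivity
  have hε1 : ε ≤ 1 := min_le_left _ _
  have hε2 : 3 * ε ≤ κ₂ := by linarith [min_le_right 1 (κ₂ / 3)]
  refine ⟨3 * κ₁ * (2 / ε) ^ S + (C * κ₁ * S.factorial + C * κ₁ * (3 / ε) ^ S), by positivity,
    fun N hN x y => ?_⟩
  have hN0 : 0 < N := by linarith
  -- The cap at 1 gives `v ≤ N`, hence `m + 1 ≤ N²`, as the heat kernel times require.
  set D := min (dist x y) 1 with hD
  have hD0 : 0 ≤ D := le_min dist_nonneg zero_le_one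
  have hD1 : D ≤ 1 := min_le_right _ _
  have hDρ : D ≤ dist x y := min_le_left _ _
  set v := N * D with hv
  have hv0 : 0 ≤ v := by positivity
  have hNq : 0 < N ^ q := by positivity
  -- For bounded `v` the Cauchy–Schwarz bound suffices; otherwise `⌊ε v⌋ - 1` is an admissible
  -- degree `m ≥ 1`, comparable to `v`.
  rcases lt_or_ge (ε * v) 2 with hz | hz
  · have hv2 : v ≤ 2 / ε := by rw [le_div_iff₀ hε0]; linarith
    have htriv : |Ξ.kernelΦ h N x y| ≤ 3 * κ₁ * N ^ q := by
      refine (Ξ.abs_kernelΦ_le hh hN0 x y).trans ?_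
      rw [← Real.sqrt_mul_self (show 0 ≤ 3 * κ₁ * N ^ q by positivity),
        ← Real.sqrt_mul (Ξ.christoffel_nonneg N x)]
      refine Real.sqrt_le_sqrt ?_
      have := Ξ.christoffel_nonneg N y
      gcongr <;> exact hb.christoffel_le _ hN
    calc _ ≤ 3 * κ₁ * N ^ q * (2 / ε) ^ S := by gcongr
      _ = 3 * κ₁ * (2 / ε) ^ S * N ^ q := by ring
      _ ≤ _ := by
          gcongr
          have : 0 ≤ C * κ₁ * S.factorial + C * κ₁ * (3 / ε) ^ S := by positivity
          linarith
  · obtain ⟨m, hm⟩ : ∃ m, ⌊ε * v⌋₊ = m + 1 :=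
      Nat.exists_eq_add_one.2 (Nat.floor_pos.2 (by linarith))
    have hm1 : 1 ≤ m := by
      have : 2 ≤ ⌊ε * v⌋₊ := Nat.le_floor (by exact_mod_cast hz)
      omega
    have hml : (m : ℝ) + 1 ≤ ε * v := by
      have := Nat.floor_le (show 0 ≤ ε * v by positivity)
      rw [hm] at this
      exact_mod_cast this
    have hmu : ε * v < m + 2 := by
      have := Nat.lt_floor_add_one (ε * v)
      rw [hm] at this
      push_cast at this
      linarith
    have hm1' : (1 : ℝ) ≤ m := by exact_mod_cast hm1
    have hvN : v ≤ N := by rw [hv]; exact mul_le_of_le_one_right hN0.le hD1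
    obtain ⟨P, hPd, hPc, hPe⟩ := hC m hm1
    have hms : (0 : ℝ) < (m : ℝ) ^ S := by positivity
    have key := hb.abs_kernelΦ_le_of_approx hH hN (m := m) (P := P) (A := C * 3 ^ m)
      (B := C / (m : ℝ) ^ S) (by nlinarith) hPd hPc
      (fun u hu => (le_div_iff₀ hms).2 (hPe u hu)) x y
    have hvm : v / m ≤ 3 / ε := by
      rw [div_le_div_iff₀ (by linarith) hε0]
      nlinarith
    have hexp : (3 : ℝ) ^ m * Real.exp (-(κ₂ * dist x y ^ 2 * N ^ 2 / (m + 1))) ≤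
        Real.exp (-v) := by
      have e1 : (3 : ℝ) ^ m ≤ Real.exp (m * 2) := by
        rw [Real.exp_nat_mul]
        gcongr
        linarith [Real.add_one_le_exp (2 : ℝ)]
      have e2 : 3 * v ≤ κ₂ * dist x y ^ 2 * N ^ 2 / (m + 1) := by
        rw [le_div_iff₀ (by linarith)]
        have e3 : v ^ 2 ≤ dist x y ^ 2 * N ^ 2 := by
          rw [hv, mul_pow, mul_comm]
          gcongr
        calc 3 * v * ((m : ℝ) + 1) ≤ 3 * v * (ε * v) := by gcongr
          _ = 3 * ε * v ^ 2 := by ring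
          _ ≤ κ₂ * (dist x y ^ 2 * N ^ 2) := by gcongr
          _ = _ := by ring
      calc _ ≤ Real.exp (m * 2) * Real.exp (-(κ₂ * dist x y ^ 2 * N ^ 2 / (m + 1))) := by gcongr
        _ = Real.exp (m * 2 + -(κ₂ * dist x y ^ 2 * N ^ 2 / (m + 1))) := (Real.exp_add _ _).symm
        _ ≤ _ := Real.exp_le_exp.2 (by nlinarith)
    have hfac : Real.exp (-v) * v ^ S ≤ S.factorial := by
      have := Real.pow_div_factorial_le_exp v hv0 S
      rw [div_le_iff₀ (by positivity)] at this
      rw [Real.exp_neg, inv_mul_le_iff₀ (Real.exp_pos _)]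
      exact this
    calc _ ≤ (C * 3 ^ m * (κ₁ * N ^ q * Real.exp (-(κ₂ * dist x y ^ 2 * N ^ 2 / (m + 1)))) +
          C / (m : ℝ) ^ S * (κ₁ * N ^ q)) * v ^ S := by gcongr
      _ = C * κ₁ * N ^ q * ((3 ^ m * Real.exp (-(κ₂ * dist x y ^ 2 * N ^ 2 / (m + 1)))) * v ^ S) +
          C * κ₁ * N ^ q * (v / m) ^ S := by
          rw [div_pow]
          field_simp
      _ ≤ C * κ₁ * N ^ q * (Real.exp (-v) * v ^ S) + C * κ₁ * N ^ q * (3 / ε) ^ S := by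
          gcongr
      _ ≤ C * κ₁ * N ^ q * S.factorial + C * κ₁ * N ^ q * (3 / ε) ^ S := by gcongr
      _ = (C * κ₁ * S.factorial + C * κ₁ * (3 / ε) ^ S) * N ^ q := by ring
      _ ≤ _ := by
          have : 0 ≤ 3 * κ₁ * (2 / ε) ^ S := by positivity
          exact mul_le_mul_of_nonneg_right (by linarith) hNq.le

end DiffusionSystem

/-! ### Uniform bounds from the data space axioms -/

theorem ENNReal.one_le_natCast {n : ℕ} (hn : 1 ≤ n) : (1 : ℝ≥0∞) ≤ n := by exact_mod_cast hn

theorem FastDecreasing.exists_bound {a : ℕ → ℝ≥0∞} (ha : FastDecreasing a) (S : ℕ) :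
    ∃ C : ℝ≥0, ∀ n : ℕ, 1 ≤ n → (n : ℝ≥0∞) ^ S * a n ≤ C := by
  -- The limit is assumed for positive exponents only, so one extra power covers `S = 0`.
  have h1 := ha.2 (S + 1) (by positivity)
  obtain ⟨N, hN⟩ := eventually_atTop.1 (h1.eventually_le_const (u := 1) (by norm_num))
  have hfin : ∑ n ∈ (Finset.range N).filter (1 ≤ ·), (n : ℝ≥0∞) ^ S * a n ≠ ∞ :=
    ENNReal.sum_ne_top.2 fun n hn => by
      have := (Finset.mem_filter.1 hn).2
      exact ENNReal.mul_ne_top (ENNReal.pow_ne_top (ENNReal.natCast_ne_top n)) (ha.1 n this).ne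
  refine ⟨(∑ n ∈ (Finset.range N).filter (1 ≤ ·), (n : ℝ≥0∞) ^ S * a n).toNNReal + 1,
    fun n hn => ?_⟩
  rw [ENNReal.coe_add, ENNReal.coe_toNNReal hfin]
  rcases lt_or_ge n N with hnN | hnN
  · exact le_add_of_le_of_nonneg (Finset.single_le_sum (f := fun n : ℕ => (n : ℝ≥0∞) ^ S * a n)
      (fun _ _ => zero_le) (by simp [hnN, hn])) zero_le
  · refine le_add_of_nonneg_of_le zero_le (le_trans ?_ (hN n hnN))
    gcongr
    rw [← ENNReal.rpow_natCast]
    exact ENNReal.rpow_le_rpow_of_exponent_le (ENNReal.one_le_natCast hn) (by simp)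

namespace DiffusionSystem

variable {X : Type*} [MetricSpace X] [MeasurableSpace X] [BorelSpace X] (Ξ : DiffusionSystem X)

/-- The square root of the Christoffel function, with values in `[0, ∞]`. -/
def sqrtChr (n : ℝ) (x : X) : ℝ≥0∞ := ENNReal.ofReal √(Ξ.christoffel n x)

theorem measurable_sqrtChr (n : ℝ) : Measurable (Ξ.sqrtChr n) := by
  have h1 : Continuous (Ξ.christoffel n) := by
    have : Ξ.christoffel n = fun x => ∑ k ∈ Ξ.idx n, Ξ.φ k x ^ 2 :=
      funext fun x => Ξ.christoffel_eq_sum n x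
    rw [this]
    exact continuous_finsetSum _ fun k _ => (Ξ.φ k).continuous.pow 2
  exact (h1.sqrt).measurable.ennreal_ofReal

theorem enorm_kernelΦ_le {h : ℝ → ℝ} (hh : IsLowPassFilter h) {N : ℝ} (hN : 0 < N) (x y : X) :
    ‖Ξ.kernelΦ h N x y‖ₑ ≤ Ξ.sqrtChr N x * Ξ.sqrtChr N y := by
  rw [Real.enorm_eq_ofReal_abs, sqrtChr, sqrtChr, ← ENNReal.ofReal_mul (Real.sqrt_nonneg _)]
  exact ENNReal.ofReal_le_ofReal (Ξ.abs_kernelΦ_le hh hN x y)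

theorem enorm_φ_le {k : ℕ} {n : ℝ} (hk : Ξ.lam k < n) (x : X) : ‖Ξ.φ k x‖ₑ ≤ Ξ.sqrtChr n x := by
  rw [Real.enorm_eq_ofReal_abs, sqrtChr]
  refine ENNReal.ofReal_le_ofReal (Real.abs_le_sqrt ?_)
  rw [christoffel_eq_sum]
  exact Finset.single_le_sum (f := fun k => Ξ.φ k x ^ 2) (fun _ _ => sq_nonneg _)
    (Ξ.mem_idx.2 hk)

theorem mul_pow_le_of_le {a C : ℝ≥0∞} {n i j : ℕ} (hn : 1 ≤ n) (hij : i ≤ j)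
    (ha : a ≤ C * (n : ℝ≥0∞) ^ i) : a ≤ C * (n : ℝ≥0∞) ^ j :=
  ha.trans (by gcongr; exact ENNReal.one_le_natCast hn)

theorem ofReal_mul_natCast_rpow_le {C a : ℝ} (hC : 0 ≤ C) {n Q : ℕ} (hn : 1 ≤ n) (ha : a ≤ Q) :
    ENNReal.ofReal (C * (n : ℝ) ^ a) ≤ (C.toNNReal : ℝ≥0∞) * (n : ℝ≥0∞) ^ Q := by
  rw [ENNReal.ofReal_mul hC]
  gcongr
  · rfl
  · rw [← ENNReal.ofReal_natCast n, ← ENNReal.ofReal_pow (Nat.cast_nonneg n), ← Real.rpow_natCast]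
    exact ENNReal.ofReal_le_ofReal
      (Real.rpow_le_rpow_of_exponent_le (by exact_mod_cast hn) ha)

/-- The quantitative consequences of the data space axioms that are used later. -/
structure Bounds (h : ℝ → ℝ) (K : ℕ → Set X) (Q : ℕ) : Prop where
  measurable : ∀ n, 1 ≤ n → MeasurableSet (K n)
  volume : ∃ C : ℝ≥0, ∀ n : ℕ, 1 ≤ n → Ξ.μ (K n) ≤ C * (n : ℝ≥0∞) ^ Q
  sqrtChr_le : ∃ C : ℝ≥0, ∀ n : ℕ, 1 ≤ n → ∀ x, Ξ.sqrtChr n x ≤ C * (n : ℝ≥0∞) ^ Q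
  sqrtChr_compl : ∀ S : ℕ, ∃ C : ℝ≥0, ∀ n : ℕ, 1 ≤ n → ∀ x ∉ K n,
    (n : ℝ≥0∞) ^ S * Ξ.sqrtChr n x ≤ C
  lintegral_compl : ∀ S : ℕ, ∃ C : ℝ≥0, ∀ n : ℕ, 1 ≤ n →
    (n : ℝ≥0∞) ^ S * ∫⁻ x in (K n)ᶜ, Ξ.sqrtChr n x ∂Ξ.μ ≤ C
  lintegral_le : ∃ C : ℝ≥0, ∀ n : ℕ, 1 ≤ n → ∫⁻ x, Ξ.sqrtChr n x ∂Ξ.μ ≤ C * (n : ℝ≥0∞) ^ Q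
  kernel_off_diag : ∀ r : ℝ, 0 < r → ∀ S : ℕ, ∃ C : ℝ≥0, ∀ n : ℕ, 1 ≤ n → ∀ x y, r ≤ dist x y →
    (n : ℝ≥0∞) ^ S * ‖Ξ.kernelΦ h n x y‖ₑ ≤ C
  kernel_near : ∃ A : ℝ≥0, ∀ n : ℕ, 1 ≤ n → ∀ x,
    ∫⁻ y in {y | dist x y < 1}, ‖Ξ.kernelΦ h n x y‖ₑ ∂Ξ.μ ≤ A

variable {Ξ}

/-- Cover the unit ball by balls of radius `2^{i+1}/n`. At scale `i` the decay `2^{-iS}` meets a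
volume of order `2^{iq} n^{-q}`; the powers of `n` cancel, and `S ≥ q + 1` leaves a geometric
series. The bound with exponent 0 covers the innermost ball. -/
theorem HeatBound.kernel_near {q κ₁ κ₂ κ : ℝ} (hb : Ξ.HeatBound q κ₁ κ₂) {h : ℝ → ℝ}
    (hh : IsLowPassFilter h) (hκ : 0 < κ)
    (hvol : ∀ (x : X) (r : ℝ), 0 < r → Ξ.μ (Metric.closedBall x r) ≤ ENNReal.ofReal (κ * r ^ q)) :
    ∃ A : ℝ≥0, ∀ n : ℕ, 1 ≤ n → ∀ x,
      ∫⁻ y in {y | dist x y < 1}, ‖Ξ.kernelΦ h n x y‖ₑ ∂Ξ.μ ≤ A := by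
  obtain ⟨S, hS⟩ := exists_nat_ge (q + 1)
  obtain ⟨C₀, hC₀, h0⟩ := hb.kernelΦ_decay hh 0
  obtain ⟨C₁, hC₁, h1⟩ := hb.kernelΦ_decay hh S
  set C := C₀ + C₁ with hC
  have hC0 : 0 ≤ C := by positivity
  refine ⟨(C * κ * 2 ^ q * 2).toNNReal, fun n hn x => ?_⟩
  have hn1 : (1 : ℝ) ≤ n := by exact_mod_cast hn
  have hn0 : (0 : ℝ) < n := by linarith
  have hnq : (0 : ℝ) < (n : ℝ) ^ q := by positivity
  have hpt : ∀ y ∈ {y | dist x y < 1}, ‖Ξ.kernelΦ h n x y‖ₑ ≤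
      ∑' i : ℕ, (Metric.closedBall x (2 ^ (i + 1) / n)).indicator
        (fun _ => ENNReal.ofReal (C * (n : ℝ) ^ q * (1 / 2 ^ i) ^ S)) y := by
    intro y hy
    simp only [Set.mem_ofPred_eq] at hy
    obtain ⟨i, hi1, hi2⟩ : ∃ i : ℕ, n * dist x y ≤ 2 ^ (i + 1) ∧
        |Ξ.kernelΦ h n x y| ≤ C * (n : ℝ) ^ q * (1 / 2 ^ i) ^ S := by
      rcases le_or_gt ((n : ℝ) * dist x y) 1 with hd | hd
      · refine ⟨0, by norm_num; linarith, ?_⟩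
        have := h0 n hn1 x y
        simp only [pow_zero, mul_one, div_one, one_pow] at this ⊢
        refine this.trans (mul_le_mul_of_nonneg_right (by linarith) hnq.le)
      · obtain ⟨i, hi1, hi2⟩ := exists_nat_pow_near hd.le (one_lt_two (α := ℝ))
        refine ⟨i, hi2.le, ?_⟩
        have h2 := h1 n hn1 x y
        rw [min_eq_left hy.le] at h2
        rw [one_div, inv_pow, ← div_eq_mul_inv, le_div_iff₀ (by positivity)]
        calc _ ≤ |Ξ.kernelΦ h n x y| * (n * dist x y) ^ S := by gcongr
          _ ≤ C₁ * (n : ℝ) ^ q := h2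
          _ ≤ _ := mul_le_mul_of_nonneg_right (by linarith) hnq.le
    refine le_trans ?_ (ENNReal.le_tsum i)
    rw [Set.indicator_of_mem, Real.enorm_eq_ofReal_abs]
    · exact ENNReal.ofReal_le_ofReal hi2
    · rw [Metric.mem_closedBall, dist_comm, le_div_iff₀ hn0]
      linarith
  have hterm : ∀ i : ℕ, ENNReal.ofReal (C * (n : ℝ) ^ q * (1 / 2 ^ i) ^ S) *
      Ξ.μ (Metric.closedBall x (2 ^ (i + 1) / n)) ≤
      ENNReal.ofReal (C * κ * 2 ^ q * (1 / 2) ^ i) := by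
    intro i
    refine (mul_le_mul' le_rfl (hvol x _ (by positivity))).trans ?_
    rw [← ENNReal.ofReal_mul (by positivity)]
    refine ENNReal.ofReal_le_ofReal ?_
    have e1 : ((2 : ℝ) ^ (i + 1) / n) ^ q = 2 ^ q * ((2 : ℝ) ^ i) ^ q / (n : ℝ) ^ q := by
      rw [Real.div_rpow (by positivity) hn0.le, pow_succ', Real.mul_rpow (by norm_num)
        (by positivity)]
    have e2 : (1 / 2 ^ i : ℝ) ^ S * ((2 : ℝ) ^ i) ^ q ≤ (1 / 2) ^ i := by
      have e3 : (1 : ℝ) ≤ 2 ^ i := one_le_pow₀ (by norm_num)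
      have e4 : ((2 : ℝ) ^ i) ^ q * 2 ^ i ≤ ((2 : ℝ) ^ i) ^ S := by
        rw [← Real.rpow_add_one (by positivity), ← Real.rpow_natCast _ S]
        exact Real.rpow_le_rpow_of_exponent_le e3 hS
      rw [one_div, inv_pow, one_div, inv_pow, inv_mul_le_iff₀ (by positivity),
        ← div_eq_mul_inv, le_div_iff₀ (by positivity)]
      exact e4
    rw [e1]
    calc _ = C * κ * 2 ^ q * ((1 / 2 ^ i : ℝ) ^ S * ((2 : ℝ) ^ i) ^ q) := by field_simp
      _ ≤ _ := by gcongr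
  calc _ ≤ ∫⁻ y in {y | dist x y < 1}, ∑' i : ℕ,
        (Metric.closedBall x (2 ^ (i + 1) / n)).indicator
        (fun _ => ENNReal.ofReal (C * (n : ℝ) ^ q * (1 / 2 ^ i) ^ S)) y ∂Ξ.μ := by
        refine setLIntegral_mono' ?_ hpt
        exact (isOpen_lt (continuous_const.dist continuous_id) continuous_const).measurableSet
    _ ≤ ∫⁻ y, ∑' i : ℕ,
        (Metric.closedBall x (2 ^ (i + 1) / n)).indicator
        (fun _ => ENNReal.ofReal (C * (n : ℝ) ^ q * (1 / 2 ^ i) ^ S)) y ∂Ξ.μ :=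
        setLIntegral_le_lintegral _ _
    _ = ∑' i : ℕ, ENNReal.ofReal (C * (n : ℝ) ^ q * (1 / 2 ^ i) ^ S) *
          Ξ.μ (Metric.closedBall x (2 ^ (i + 1) / n)) := by
        rw [lintegral_tsum fun i =>
          (measurable_const.indicator Metric.isClosed_closedBall.measurableSet).aemeasurable]
        congr 1
        funext i
        rw [lintegral_indicator_const Metric.isClosed_closedBall.measurableSet]
    _ ≤ ∑' i : ℕ, ENNReal.ofReal (C * κ * 2 ^ q * (1 / 2) ^ i) := ENNReal.tsum_le_tsum hterm
    _ = ENNReal.ofReal (C * κ * 2 ^ q * 2) := by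
        rw [← ENNReal.ofReal_tsum_of_nonneg (fun i => by positivity)
          (summable_geometric_two.mul_left _), tsum_mul_left, tsum_geometric_two]
    _ = _ := rfl

theorem IsDataSpace.exists_bounds (hΞ : Ξ.IsDataSpace) {h : ℝ → ℝ} (hh : IsLowPassFilter h) :
    ∃ K Q, Ξ.Bounds h K Q := by
  obtain ⟨q, hq, ⟨κ, hκ, hvol⟩, κ₁, κ₂, hκ₁, hκ₂, hheat⟩ := hΞ.ball_and_gaussian
  have hb : Ξ.HeatBound q κ₁ κ₂ := ⟨hq, hκ₁, hκ₂, fun x y t h0 h1 => (hheat x y t h0 h1).1,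
    fun x y t h0 h1 => (hheat x y t h0 h1).2⟩
  obtain ⟨K, hK, ⟨c₁, c₂, hc₁, hc₂, hdiam⟩, hf1, hf2⟩ := hΞ.essential_compactness
  obtain ⟨Q₁, hQ₁⟩ := exists_nat_ge (c₂ * q)
  obtain ⟨Q₂, hQ₂⟩ := exists_nat_ge q
  have hKm : ∀ n, 1 ≤ n → MeasurableSet (K n) := fun n hn => (hK n hn).isClosed.measurableSet
  have hKv : ∀ n : ℕ, 1 ≤ n →
      Ξ.μ (K n) ≤ ((κ * (c₁ + 1) ^ q).toNNReal : ℝ≥0∞) * (n : ℝ≥0∞) ^ Q₁ := by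
    intro n hn
    have hn1 : (1 : ℝ) ≤ n := by exact_mod_cast hn
    rcases (K n).eq_empty_or_nonempty with he | ⟨x, hx⟩
    · simp [he]
    have h1 : K n ⊆ Metric.closedBall x ((c₁ + 1) * (n : ℝ) ^ c₂) := fun y hy => by
      rw [Metric.mem_closedBall]
      refine (Metric.dist_le_diam_of_mem (hK n hn).isBounded hy hx).trans ?_
      refine ((le_abs_self _).trans (hdiam n hn)).trans ?_
      gcongr
      linarith
    refine (measure_mono h1).trans ((hvol x _ (by positivity)).2.trans ?_)
    rw [Real.mul_rpow (by positivity) (by positivity), ← mul_assoc, ← Real.rpow_mul (by positivity)]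
    exact ofReal_mul_natCast_rpow_le (by positivity) hn hQ₁
  have hchr : ∀ n : ℕ, 1 ≤ n → ∀ x,
      Ξ.sqrtChr n x ≤ ((3 * κ₁ + 1).toNNReal : ℝ≥0∞) * (n : ℝ≥0∞) ^ Q₂ := by
    intro n hn x
    have hn1 : (1 : ℝ) ≤ n := by exact_mod_cast hn
    refine le_trans (ENNReal.ofReal_le_ofReal ?_)
      (ofReal_mul_natCast_rpow_le (by positivity) hn hQ₂)
    have h1 := hb.christoffel_le x hn1
    have h2 : (1 : ℝ) ≤ (n : ℝ) ^ q := Real.one_le_rpow hn1 (by linarith)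
    -- The summand 1 in the constant makes the bound at least 1, hence at most its own square.
    refine Real.sqrt_le_iff.2 ⟨by positivity, ?_⟩
    refine h1.trans ?_
    have h3 : 1 ≤ (3 * κ₁ + 1) * (n : ℝ) ^ q := by nlinarith
    nlinarith
  have hcompl : ∀ S : ℕ, ∃ C : ℝ≥0, ∀ n : ℕ, 1 ≤ n →
      (n : ℝ≥0∞) ^ S * ∫⁻ x in (K n)ᶜ, Ξ.sqrtChr n x ∂Ξ.μ ≤ C := hf2.exists_bound
  refine ⟨K, Q₁ + Q₂, hKm, ⟨_, fun n hn => mul_pow_le_of_le hn (by omega) (hKv n hn)⟩,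
    ⟨_, fun n hn x => mul_pow_le_of_le hn (by omega) (hchr n hn x)⟩, fun S => ?_, hcompl,
    ?_, fun r hr S => ?_, hb.kernel_near hh hκ fun x r hr => (hvol x r hr).2⟩
  -- The exponent is doubled because the axiom controls the square of `sqrtChr`.
  · obtain ⟨C, hC⟩ := hf1.exists_bound (S * 2)
    refine ⟨C + 1, fun n hn x hx => ?_⟩
    have h1 : ((n : ℝ≥0∞) ^ S * Ξ.sqrtChr n x) ^ 2 ≤ C := by
      refine le_trans ?_ (hC n hn)
      rw [mul_pow, ← pow_mul]
      gcongr
      rw [sqrtChr, ← ENNReal.ofReal_pow (Real.sqrt_nonneg _),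
        Real.sq_sqrt (Ξ.christoffel_nonneg _ _)]
      exact le_iSup₂ (f := fun x (_ : x ∈ (K n)ᶜ) => ENNReal.ofReal (Ξ.christoffel n x)) x hx
    rw [ENNReal.coe_add, ENNReal.coe_one]
    set a := (n : ℝ≥0∞) ^ S * Ξ.sqrtChr n x
    rcases le_total a 1 with h2 | h2
    · exact h2.trans le_add_self
    · exact (le_self_pow₀ h2 two_ne_zero).trans (h1.trans le_self_add)
  · obtain ⟨C, hC⟩ := hcompl 0
    refine ⟨(3 * κ₁ + 1).toNNReal * (κ * (c₁ + 1) ^ q).toNNReal + C, fun n hn => ?_⟩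
    rw [← lintegral_add_compl _ (hKm n hn), ENNReal.coe_add, add_mul]
    refine add_le_add ?_ ?_
    · calc _ ≤ ∫⁻ _ in K n, ((3 * κ₁ + 1).toNNReal : ℝ≥0∞) * (n : ℝ≥0∞) ^ Q₂ ∂Ξ.μ :=
            lintegral_mono fun x => hchr n hn x
        _ = ((3 * κ₁ + 1).toNNReal : ℝ≥0∞) * (n : ℝ≥0∞) ^ Q₂ * Ξ.μ (K n) := by
            rw [setLIntegral_const]
        _ ≤ ((3 * κ₁ + 1).toNNReal : ℝ≥0∞) * (n : ℝ≥0∞) ^ Q₂ *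
            (((κ * (c₁ + 1) ^ q).toNNReal : ℝ≥0∞) * (n : ℝ≥0∞) ^ Q₁) := by
            gcongr; exact hKv n hn
        _ = _ := by rw [ENNReal.coe_mul, pow_add]; ring
    · have := hC n hn
      rw [pow_zero, one_mul] at this
      refine mul_pow_le_of_le hn (Nat.zero_le _) ?_
      rwa [pow_zero, mul_one]
  -- The extra `Q₂` powers absorb the factor `n^q`.
  · obtain ⟨C, hC0, hC⟩ := hb.kernelΦ_decay hh (S + Q₂)
    have hr' : 0 < min r 1 := by positivity
    refine ⟨(C / (min r 1) ^ (S + Q₂)).toNNReal, fun n hn x y hxy => ?_⟩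
    have hn1 : (1 : ℝ) ≤ n := by exact_mod_cast hn
    have hn0 : (0 : ℝ) < n := by linarith
    have h1 := hC n hn1 x y
    have h2 : |Ξ.kernelΦ h n x y| * (n * min r 1) ^ (S + Q₂) ≤ C * (n : ℝ) ^ Q₂ := by
      refine le_trans ?_ (h1.trans ?_)
      · gcongr
      · gcongr
        rw [← Real.rpow_natCast]
        exact Real.rpow_le_rpow_of_exponent_le hn1 hQ₂
    have h3 : (n : ℝ) ^ S * |Ξ.kernelΦ h n x y| ≤ C / (min r 1) ^ (S + Q₂) := by
      rw [le_div_iff₀ (by positivity)]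
      refine le_of_mul_le_mul_right ?_ (show (0 : ℝ) < (n : ℝ) ^ Q₂ by positivity)
      refine le_trans (le_of_eq ?_) h2
      rw [mul_pow, pow_add (n : ℝ)]
      ring
    rw [Real.enorm_eq_ofReal_abs, ← ENNReal.ofReal_natCast n,
      ← ENNReal.ofReal_pow (Nat.cast_nonneg n), ← ENNReal.ofReal_mul (by positivity)]
    exact ENNReal.ofReal_le_ofReal h3

/-- The kernels `Φ_n` are negligible away from the diagonal. -/
theorem Bounds.kernel_far {h : ℝ → ℝ} {K : ℕ → Set X} {Q : ℕ} (hB : Ξ.Bounds h K Q)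
    (hh : IsLowPassFilter h) {r : ℝ} (hr : 0 < r) (S : ℕ) :
    ∃ C : ℝ≥0, ∀ n : ℕ, 1 ≤ n → ∀ x,
      (n : ℝ≥0∞) ^ S * ∫⁻ y in {y | r ≤ dist x y}, ‖Ξ.kernelΦ h n x y‖ₑ ∂Ξ.μ ≤ C := by
  obtain ⟨C₁, h1⟩ := hB.volume
  obtain ⟨C₂, h2⟩ := hB.sqrtChr_le
  obtain ⟨C₃, h3⟩ := hB.lintegral_le
  obtain ⟨C₄, h4⟩ := hB.sqrtChr_compl (S + Q)
  obtain ⟨C₅, h5⟩ := hB.lintegral_compl (S + Q)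
  obtain ⟨C₆, h6⟩ := hB.kernel_off_diag r hr (S + Q)
  refine ⟨C₄ * C₃ + (C₆ * C₁ + C₂ * C₅), fun n hn x => ?_⟩
  have hn0 : (0 : ℝ) < n := by exact_mod_cast hn
  have hle := Ξ.enorm_kernelΦ_le hh hn0 x
  have hm := Ξ.measurable_sqrtChr n
  set F : Set X := {y | r ≤ dist x y} with hF
  have hFm : MeasurableSet F :=
    (isClosed_le continuous_const (continuous_const.dist continuous_id)).measurableSet
  -- Off-diagonal decay is only a uniform bound, useless on infinite volume. It is used for `x, y ∈
  -- K n`, whose volume is polynomial; elsewhere the kernel is at most `sqrtChr n x * sqrtChr n y`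
  -- with one factor negligible.
  by_cases hx : x ∈ K n
  · have e1 : ∫⁻ y in F, ‖Ξ.kernelΦ h n x y‖ₑ ∂Ξ.μ ≤
        ∫⁻ y in F ∩ K n, ‖Ξ.kernelΦ h n x y‖ₑ ∂Ξ.μ +
        ∫⁻ y in (K n)ᶜ, ‖Ξ.kernelΦ h n x y‖ₑ ∂Ξ.μ := by
      refine le_trans (lintegral_mono_set ?_) (lintegral_union_le _ _ _)
      intro y hy
      by_cases hyK : y ∈ K n
      · exact Or.inl ⟨hy, hyK⟩
      · exact Or.inr hyK
    have e2 : (n : ℝ≥0∞) ^ S * ∫⁻ y in F ∩ K n, ‖Ξ.kernelΦ h n x y‖ₑ ∂Ξ.μ ≤ C₆ * C₁ := by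
      have hn0' : (n : ℝ≥0∞) ^ (S + Q) ≠ ∞ := ENNReal.pow_ne_top (ENNReal.natCast_ne_top n)
      calc _ ≤ (n : ℝ≥0∞) ^ S * ((∫⁻ _ in F ∩ K n, C₆ / (n : ℝ≥0∞) ^ (S + Q) ∂Ξ.μ)) := by
            gcongr 1
            refine setLIntegral_mono' (hFm.inter (hB.measurable n hn)) fun y hy => ?_
            rw [ENNReal.le_div_iff_mul_le (Or.inl (by positivity)) (Or.inl hn0'), mul_comm]
            exact h6 n hn x y hy.1
        _ ≤ (n : ℝ≥0∞) ^ S * (C₆ / (n : ℝ≥0∞) ^ (S + Q) * (C₁ * (n : ℝ≥0∞) ^ Q)) := by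
            rw [setLIntegral_const]
            gcongr
            exact (measure_mono Set.inter_subset_right).trans (h1 n hn)
        _ = C₆ * C₁ * ((n : ℝ≥0∞) ^ (S + Q) / (n : ℝ≥0∞) ^ (S + Q)) := by
            rw [pow_add, div_eq_mul_inv, div_eq_mul_inv]; ring
        _ ≤ _ := mul_le_of_le_one_right' (ENNReal.div_self_le_one)
    have e3 : (n : ℝ≥0∞) ^ S * ∫⁻ y in (K n)ᶜ, ‖Ξ.kernelΦ h n x y‖ₑ ∂Ξ.μ ≤ C₂ * C₅ := by
      calc _ ≤ (n : ℝ≥0∞) ^ S * ∫⁻ y in (K n)ᶜ, Ξ.sqrtChr n x * Ξ.sqrtChr n y ∂Ξ.μ := by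
            gcongr with y; exact hle y
        _ = (n : ℝ≥0∞) ^ S * (Ξ.sqrtChr n x * ∫⁻ y in (K n)ᶜ, Ξ.sqrtChr n y ∂Ξ.μ) := by
            rw [lintegral_const_mul _ hm]
        _ ≤ (n : ℝ≥0∞) ^ S * ((C₂ * (n : ℝ≥0∞) ^ Q) * ∫⁻ y in (K n)ᶜ, Ξ.sqrtChr n y ∂Ξ.μ) := by
            gcongr; exact h2 n hn x
        _ = C₂ * ((n : ℝ≥0∞) ^ (S + Q) * ∫⁻ y in (K n)ᶜ, Ξ.sqrtChr n y ∂Ξ.μ) := by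
            rw [pow_add]; ring
        _ ≤ _ := by gcongr; exact h5 n hn
    calc _ ≤ (n : ℝ≥0∞) ^ S * (∫⁻ y in F ∩ K n, ‖Ξ.kernelΦ h n x y‖ₑ ∂Ξ.μ +
        ∫⁻ y in (K n)ᶜ, ‖Ξ.kernelΦ h n x y‖ₑ ∂Ξ.μ) := by gcongr
      _ ≤ C₆ * C₁ + C₂ * C₅ := by rw [mul_add]; exact add_le_add e2 e3
      _ ≤ _ := by push_cast; exact le_add_self
  · calc _ ≤ (n : ℝ≥0∞) ^ S * ∫⁻ y, Ξ.sqrtChr n x * Ξ.sqrtChr n y ∂Ξ.μ := by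
          refine mul_le_mul' le_rfl ?_
          exact (lintegral_mono fun y => hle y).trans (setLIntegral_le_lintegral _ _)
      _ = (n : ℝ≥0∞) ^ S * (Ξ.sqrtChr n x * ∫⁻ y, Ξ.sqrtChr n y ∂Ξ.μ) := by
          rw [lintegral_const_mul _ hm]
      _ ≤ (n : ℝ≥0∞) ^ S * (Ξ.sqrtChr n x * (C₃ * (n : ℝ≥0∞) ^ Q)) := by
          gcongr; exact h3 n hn
      _ = (n : ℝ≥0∞) ^ (S + Q) * Ξ.sqrtChr n x * C₃ := by rw [pow_add]; ring
      _ ≤ C₄ * C₃ := by gcongr; exact h4 n hn x hx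
      _ ≤ _ := by push_cast; exact le_self_add

/-- The kernels `Φ_n` are uniformly integrable in each variable. -/
theorem Bounds.kernel_bound {h : ℝ → ℝ} {K : ℕ → Set X} {Q : ℕ} (hB : Ξ.Bounds h K Q)
    (hh : IsLowPassFilter h) :
    ∃ A : ℝ≥0, ∀ n : ℕ, 1 ≤ n → ∀ x, ∫⁻ y, ‖Ξ.kernelΦ h n x y‖ₑ ∂Ξ.μ ≤ A := by
  obtain ⟨A, hA⟩ := hB.kernel_near
  obtain ⟨C, hC⟩ := hB.kernel_far hh one_pos 0
  refine ⟨A + C, fun n hn x => ?_⟩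
  have h1 := hC n hn x
  rw [pow_zero, one_mul] at h1
  rw [← setLIntegral_univ, ENNReal.coe_add]
  refine le_trans (lintegral_mono_set (t := {y | dist x y < 1} ∪ {y | 1 ≤ dist x y}) ?_)
    ((lintegral_union_le _ _ _).trans (add_le_add (hA n hn x) h1))
  exact fun y _ => lt_or_ge (dist x y) 1

end DiffusionSystem

/-! ### Integral operators and norms between `L¹` and `L^∞` -/

namespace MeasureTheory

variable {α : Type*} [MeasurableSpace α] {μ : Measure α}

/-- The Schur test. -/
theorem eLpNorm_lintegral_mul_le [SFinite μ] {k : α → α → ℝ≥0∞}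
    (hk : Measurable (Function.uncurry k)) {A : ℝ≥0∞} (hA : A ≠ ∞)
    (h₁ : ∀ x, ∫⁻ y, k x y ∂μ ≤ A) (h₂ : ∀ y, ∫⁻ x, k x y ∂μ ≤ A)
    {F : α → ℝ≥0∞} (hF : AEMeasurable F μ) {p : ℝ≥0∞} (hp : 1 ≤ p) :
    eLpNorm (fun x => ∫⁻ y, F y * k x y ∂μ) p μ ≤ A * eLpNorm F p μ := by
  have hkx : ∀ x, Measurable (k x) := fun x => hk.comp measurable_prodMk_left
  rcases eq_or_ne p ∞ with rfl | hp'
  · have h3 : ∀ x, ‖∫⁻ y, F y * k x y ∂μ‖ₑ ≤ A * eLpNorm F ∞ μ := fun x => by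
      have hae : ∀ᵐ y ∂μ, F y * k x y ≤ eLpNorm F ∞ μ * k x y := by
        have := enorm_ae_le_eLpNormEssSup F μ
        filter_upwards [this] with y hy
        rw [eLpNorm_exponent_top]
        exact mul_le_mul' hy le_rfl
      calc _ ≤ ∫⁻ y, eLpNorm F ∞ μ * k x y ∂μ := lintegral_mono_ae hae
        _ = eLpNorm F ∞ μ * ∫⁻ y, k x y ∂μ := lintegral_const_mul _ (hkx x)
        _ ≤ _ := by rw [mul_comm]; exact mul_le_mul' (h₁ x) le_rfl
    rw [eLpNorm_exponent_top]
    exact essSup_le_of_ae_le _ (ae_of_all _ h3)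
  · have hp0 : p ≠ 0 := (zero_lt_one.trans_le hp).ne'
    set P := p.toReal with hP
    have hP1 : 1 ≤ P := by
      rw [hP, ← ENNReal.toReal_one]
      exact ENNReal.toReal_mono hp' hp
    have hP0 : 0 < P := by linarith
    rw [eLpNorm_eq_lintegral_rpow_enorm_toReal hp0 hp',
      eLpNorm_eq_lintegral_rpow_enorm_toReal hp0 hp']
    simp only [enorm_eq_self, ← hP]
    have hFk : ∀ x, AEMeasurable (fun y => F y ^ P * k x y) μ := fun x =>
      (hF.pow_const P).mul (hkx x).aemeasurable
    -- Hölder applied to `F k = (F^P k)^{1/P} k^{1-1/P}`.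
    have hpt : ∀ x, (∫⁻ y, F y * k x y ∂μ) ^ P ≤
        A ^ (P - 1) * ∫⁻ y, F y ^ P * k x y ∂μ := fun x => by
      have h3 := ENNReal.lintegral_mul_norm_pow_le (hFk x) (hkx x).aemeasurable
        (p := 1 / P) (q := 1 - 1 / P) (by positivity)
        (by rw [sub_nonneg, div_le_one hP0]; exact hP1) (by ring)
      have h4 : ∀ y, (F y ^ P * k x y) ^ (1 / P) * k x y ^ (1 - 1 / P) = F y * k x y := fun y => by
        rw [ENNReal.mul_rpow_of_nonneg _ _ (by positivity), ← ENNReal.rpow_mul,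
          mul_one_div_cancel hP0.ne', ENNReal.rpow_one, mul_assoc,
          ← ENNReal.rpow_add_of_nonneg _ _ (by positivity)
            (by rw [sub_nonneg, div_le_one hP0]; exact hP1)]
        simp
      simp only [h4] at h3
      calc _ ≤ ((∫⁻ y, F y ^ P * k x y ∂μ) ^ (1 / P) * A ^ (1 - 1 / P)) ^ P := by
            refine ENNReal.rpow_le_rpow (h3.trans ?_) hP0.le
            refine mul_le_mul' le_rfl (ENNReal.rpow_le_rpow (h₁ x) ?_)
            rw [sub_nonneg, div_le_one hP0]; exact hP1
        _ = _ := by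
            rw [ENNReal.mul_rpow_of_nonneg _ _ hP0.le, ← ENNReal.rpow_mul, ← ENNReal.rpow_mul,
              one_div_mul_cancel hP0.ne', ENNReal.rpow_one, mul_comm]
            congr 2
            field_simp
    have hint : ∫⁻ x, (∫⁻ y, F y * k x y ∂μ) ^ P ∂μ ≤ A ^ P * ∫⁻ y, F y ^ P ∂μ := by
      have hm : AEMeasurable (Function.uncurry fun x y => F y ^ P * k x y) (μ.prod μ) :=
        ((hF.pow_const P).comp_snd).mul hk.aemeasurable
      have hAP : A ^ (P - 1) ≠ ∞ := ENNReal.rpow_ne_top_of_nonneg (by linarith) hA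
      calc _ ≤ ∫⁻ x, A ^ (P - 1) * ∫⁻ y, F y ^ P * k x y ∂μ ∂μ := lintegral_mono hpt
        _ = A ^ (P - 1) * ∫⁻ y, ∫⁻ x, F y ^ P * k x y ∂μ ∂μ := by
            rw [lintegral_const_mul' _ _ hAP, lintegral_lintegral_swap hm]
        _ ≤ A ^ (P - 1) * ∫⁻ y, A * F y ^ P ∂μ := by
            gcongr with y
            rw [lintegral_const_mul _ (show Measurable fun x => k x y from
              hk.comp measurable_prodMk_right), mul_comm]
            exact mul_le_mul' (h₂ y) le_rfl
        _ = _ := by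
            rw [lintegral_const_mul' _ _ hA, ← mul_assoc]
            congr 1
            nth_rewrite 2 [← ENNReal.rpow_one A]
            rw [← ENNReal.rpow_add_of_nonneg _ _ (by linarith) zero_le_one, sub_add_cancel]
    calc _ ≤ (A ^ P * ∫⁻ y, F y ^ P ∂μ) ^ (1 / P) := ENNReal.rpow_le_rpow hint (by positivity)
      _ = _ := by
          rw [ENNReal.mul_rpow_of_nonneg _ _ (by positivity), ← ENNReal.rpow_mul,
            mul_one_div_cancel hP0.ne', ENNReal.rpow_one]

/-- Pointwise `|g|^p ≤ M^{p-1} |g|` almost everywhere. This lets estimates given only for `p = 1, ∞`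
serve all `p` with the same constant. -/
theorem eLpNorm_le_max_one_top {g : α → ℝ} {p : ℝ≥0∞} (hp : 1 ≤ p) :
    eLpNorm g p μ ≤ max (eLpNorm g 1 μ) (eLpNorm g ∞ μ) := by
  set M := max (eLpNorm g 1 μ) (eLpNorm g ∞ μ) with hM
  rcases eq_or_ne p ∞ with rfl | hp'
  · exact le_max_right _ _
  rcases eq_or_ne M ∞ with hMt | hMt
  · rw [hMt]; exact le_top
  have hp0 : p ≠ 0 := (zero_lt_one.trans_le hp).ne'
  rw [eLpNorm_eq_lintegral_rpow_enorm_toReal hp0 hp']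
  set P := p.toReal with hP
  have hP1 : 1 ≤ P := by
    rw [hP, ← ENNReal.toReal_one]
    exact ENNReal.toReal_mono hp' hp
  have hP0 : 0 < P := by linarith
  have hae : ∀ᵐ x ∂μ, ‖g x‖ₑ ^ P ≤ M ^ (P - 1) * ‖g x‖ₑ := by
    filter_upwards [enorm_ae_le_eLpNormEssSup g μ] with x hx
    rw [← eLpNorm_exponent_top] at hx
    have : ‖g x‖ₑ ^ P = ‖g x‖ₑ ^ (P - 1) * ‖g x‖ₑ := by
      nth_rewrite 3 [← ENNReal.rpow_one ‖g x‖ₑ]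
      rw [← ENNReal.rpow_add_of_nonneg _ _ (by linarith) zero_le_one, sub_add_cancel]
    rw [this]
    exact mul_le_mul' (ENNReal.rpow_le_rpow (hx.trans (le_max_right _ _)) (by linarith)) le_rfl
  have h1 : ∫⁻ x, ‖g x‖ₑ ^ P ∂μ ≤ M ^ P := by
    calc _ ≤ ∫⁻ x, M ^ (P - 1) * ‖g x‖ₑ ∂μ := lintegral_mono_ae hae
      _ = M ^ (P - 1) * eLpNorm g 1 μ := by
          rw [lintegral_const_mul' _ _ (ENNReal.rpow_ne_top_of_nonneg (by linarith) hMt),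
            eLpNorm_one_eq_lintegral_enorm]
      _ ≤ M ^ (P - 1) * M ^ (1 : ℝ) := by
          rw [ENNReal.rpow_one]
          exact mul_le_mul' le_rfl (le_max_left _ _)
      _ = _ := by
          rw [← ENNReal.rpow_add_of_nonneg _ _ (by linarith) zero_le_one, sub_add_cancel]
  calc _ ≤ (M ^ P) ^ (1 / P) := ENNReal.rpow_le_rpow h1 (by positivity)
    _ = M := by rw [← ENNReal.rpow_mul, mul_one_div_cancel hP0.ne', ENNReal.rpow_one]

/-- Hölder, with the conjugate norm of `g` replaced by the two endpoint norms, so that no conjugate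
exponent is carried along. -/
theorem enorm_integral_mul_le {f g : α → ℝ} (hf : AEStronglyMeasurable f μ)
    (hg : AEStronglyMeasurable g μ) {p : ℝ≥0∞} (hp : 1 ≤ p) :
    ∫⁻ x, ‖f x * g x‖ₑ ∂μ ≤ eLpNorm f p μ * max (eLpNorm g 1 μ) (eLpNorm g ∞ μ) := by
  have := ENNReal.HolderConjugate.conjExponent hp
  have h1 := eLpNorm_le_eLpNorm_mul_eLpNorm_of_nnnorm (p := p) (q := p.conjExponent) (r := 1)
    hf hg (fun a b => a * b) 1 (ae_of_all _ fun x => by simp)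
  rw [eLpNorm_one_eq_lintegral_enorm, ENNReal.coe_one, one_mul] at h1
  refine h1.trans (mul_le_mul' le_rfl (eLpNorm_le_max_one_top ?_))
  exact ENNReal.HolderConjugate.one_le p.conjExponent p

end MeasureTheory

/-! ### Telescoping with geometric weights -/

/-- Telescoping estimates between the errors `e n = ‖f - g n‖` and the increments
`t (n + 1) = ‖g (n + 1) - g n‖`, with geometric weights. -/
theorem exists_telescoping_const {ρ : ℝ≥0∞} (h1 : 1 < ρ) (hρ : ρ ≠ ∞) :
    ∃ c : ℝ≥0, ∀ (e t : ℕ → ℝ≥0∞) (F : ℝ≥0∞), (∀ n, e n ≤ t (n + 1) + e (n + 1)) →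
      (∀ n, t (n + 1) ≤ e n + e (n + 1)) → F ≤ t 0 + e 0 → t 0 ≤ F + e 0 →
      Tendsto e atTop (𝓝 0) →
      ⨆ n, ρ ^ n * e n ≤ c * ⨆ (j : ℕ) (_ : 1 ≤ j), ρ ^ j * t j ∧
      ⨆ (j : ℕ) (_ : 1 ≤ j), ρ ^ j * t j ≤ c * ⨆ n, ρ ^ n * e n ∧
      F + ⨆ n, ρ ^ n * e n ≤ c * ⨆ (j : ℕ) (_ : 0 ≤ j), ρ ^ j * t j ∧
      ⨆ (j : ℕ) (_ : 0 ≤ j), ρ ^ j * t j ≤ c * (F + ⨆ n, ρ ^ n * e n) := by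
  have hρ0 : ρ ≠ 0 := (zero_lt_one.trans h1).ne'
  set s : ℝ≥0∞ := ∑' i : ℕ, ρ⁻¹ ^ (i + 1) with hs
  have hsfin : s ≠ ∞ := by
    have h2 : ρ⁻¹ < 1 := ENNReal.inv_lt_one.2 h1
    rw [hs]
    simp_rw [pow_succ]
    rw [ENNReal.tsum_mul_right, ENNReal.tsum_geometric]
    refine ENNReal.mul_ne_top (ENNReal.inv_ne_top.2 (tsub_pos_of_lt h2).ne') ?_
    exact (h2.trans_le le_top).ne
  -- One constant for all four inequalities, which by themselves need `s`, `ρ + 1`, `2s + 1` and `ρ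
  -- + 2`.
  refine ⟨(2 * s + ρ + 3).toNNReal, fun e t F he ht hF ht0 hlim => ?_⟩
  rw [ENNReal.coe_toNNReal (by finiteness)]
  set E := ⨆ n, ρ ^ n * e n with hE
  set T := ⨆ (j : ℕ) (_ : 1 ≤ j), ρ ^ j * t j with hT
  set T₀ := ⨆ (j : ℕ) (_ : 0 ≤ j), ρ ^ j * t j with hT₀
  have hTT₀ : T ≤ T₀ := iSup_le fun j => iSup_le fun _ =>
    le_iSup₂ (f := fun (j : ℕ) (_ : 0 ≤ j) => ρ ^ j * t j) j (Nat.zero_le j)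
  have ht0T : t 0 ≤ T₀ := by
    calc t 0 = ρ ^ 0 * t 0 := by simp
      _ ≤ T₀ := le_iSup₂ (f := fun (j : ℕ) (_ : 0 ≤ j) => ρ ^ j * t j) 0 le_rfl
  have he0E : e 0 ≤ E := by simpa using le_iSup (fun n => ρ ^ n * e n) 0
  have htj : ∀ j, 1 ≤ j → t j ≤ ρ⁻¹ ^ j * T := fun j hj => by
    rw [← ENNReal.inv_pow, ← ENNReal.div_eq_inv_mul,
      ENNReal.le_div_iff_mul_le (Or.inl (pow_ne_zero _ hρ0)) (Or.inl (ENNReal.pow_ne_top hρ)),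
      mul_comm]
    exact le_iSup₂ (f := fun (j : ℕ) (_ : 1 ≤ j) => ρ ^ j * t j) j hj
  have hfin : ∀ n N, e n ≤ ∑ i ∈ Finset.range N, t (n + 1 + i) + e (n + N) := fun n N => by
    induction N with
    | zero => simp
    | succ N ih =>
      refine ih.trans ?_
      rw [Finset.sum_range_succ, add_assoc]
      gcongr
      rw [show n + 1 + N = n + N + 1 by ring]
      exact he (n + N)
  have hEsT : E ≤ s * T := by
    refine iSup_le fun n => ?_
    -- Bound `e n` by finitely many increments and a later error, sum the geometric series, and let
    -- that error tend to 0. Nothing requires `T` to be finite.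
    have h3 : e n ≤ ρ⁻¹ ^ n * (s * T) := by
      have hb : ∀ N, e n ≤ ρ⁻¹ ^ n * (s * T) + e (n + N) := fun N => by
        refine (hfin n N).trans ?_
        gcongr
        calc _ ≤ ∑ i ∈ Finset.range N, ρ⁻¹ ^ n * (ρ⁻¹ ^ (i + 1) * T) := by
              refine Finset.sum_le_sum fun i _ => (htj _ (by omega)).trans (le_of_eq ?_)
              rw [← mul_assoc, ← pow_add]
              congr 2
              ring
          _ = ρ⁻¹ ^ n * ((∑ i ∈ Finset.range N, ρ⁻¹ ^ (i + 1)) * T) := by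
              rw [Finset.sum_mul, Finset.mul_sum]
          _ ≤ _ := by gcongr; exact ENNReal.sum_le_tsum _
      have hl : Tendsto (fun N => ρ⁻¹ ^ n * (s * T) + e (n + N)) atTop
          (𝓝 (ρ⁻¹ ^ n * (s * T) + 0)) := by
        refine tendsto_const_nhds.add ?_
        have := (tendsto_add_atTop_iff_nat n).2 hlim
        simpa only [add_comm] using this
      rw [add_zero] at hl
      exact ge_of_tendsto' hl hb
    calc _ ≤ ρ ^ n * (ρ⁻¹ ^ n * (s * T)) := by gcongr
      _ = (ρ * ρ⁻¹) ^ n * (s * T) := by rw [mul_pow, mul_assoc]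
      _ = s * T := by rw [ENNReal.mul_inv_cancel hρ0 hρ, one_pow, one_mul]
  have hTE : T ≤ (ρ + 1) * E := by
    refine iSup_le fun j => iSup_le fun hj => ?_
    obtain ⟨n, rfl⟩ := Nat.exists_eq_add_of_le' hj
    calc _ ≤ ρ ^ (n + 1) * (e n + e (n + 1)) := by gcongr; exact ht n
      _ = ρ * (ρ ^ n * e n) + ρ ^ (n + 1) * e (n + 1) := by ring
      _ ≤ ρ * E + E := by
          gcongr
          · exact le_iSup (fun n => ρ ^ n * e n) n
          · exact le_iSup (fun n => ρ ^ n * e n) (n + 1)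
      _ = _ := by ring
  have hT₀le : T₀ ≤ t 0 + T := by
    refine iSup_le fun j => iSup_le fun _ => ?_
    rcases Nat.eq_zero_or_pos j with rfl | hj
    · simp
    · exact (le_iSup₂ (f := fun (j : ℕ) (_ : 1 ≤ j) => ρ ^ j * t j) j hj).trans le_add_self
  refine ⟨hEsT.trans ?_, hTE.trans ?_, ?_, ?_⟩
  · refine mul_le_mul' ?_ le_rfl
    calc s ≤ s + (s + ρ + 3) := le_self_add
      _ = _ := by ring
  · refine mul_le_mul' ?_ le_rfl
    calc ρ + 1 ≤ (ρ + 1) + (2 * s + 2) := le_self_add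
      _ = _ := by ring
  · calc F + E ≤ (t 0 + E) + E := by gcongr; exact hF.trans (by gcongr)
      _ ≤ (T₀ + s * T₀) + s * T₀ := by
          have : E ≤ s * T₀ := hEsT.trans (by gcongr)
          gcongr
      _ ≤ (T₀ + s * T₀) + s * T₀ + (ρ + 2) * T₀ := le_self_add
      _ = _ := by ring
  · calc T₀ ≤ (F + E) + (ρ + 1) * E := hT₀le.trans (by gcongr; exact ht0.trans (by gcongr))
      _ ≤ (F + E) + (ρ + 1) * E + ((ρ + 1) * F + (2 * s + 1) * (F + E)) := le_self_add
      _ = _ := by ring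

theorem ZeroAtInftyContinuousMap.sum_smul_apply {X ι : Type*} [TopologicalSpace X] (s : Finset ι)
    (c : ι → ℝ) (g : ι → C₀(X, ℝ)) (x : X) :
    (∑ k ∈ s, c k • g k : C₀(X, ℝ)) x = ∑ k ∈ s, c k * g k x := by
  classical
  induction s using Finset.induction_on with
  | empty => simp
  | insert a s ha ih =>
    rw [Finset.sum_insert ha, Finset.sum_insert ha, ZeroAtInftyContinuousMap.add_apply, ih,
      ZeroAtInftyContinuousMap.smul_apply, smul_eq_mul]

/-! ### The operators with kernels `Φ_n` and `Ψ_n` on `L^p` -/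

namespace DiffusionSystem

variable {X : Type*} [MetricSpace X] [MeasurableSpace X] [BorelSpace X] {Ξ : DiffusionSystem X}

instance (Ξ : DiffusionSystem X) : SigmaFinite Ξ.μ := Ξ.sigmaFinite

/-- Compact balls make the space proper. Second countability is needed for the distance to be
measurable on the product, hence for cutting kernels off near the diagonal. -/
theorem IsDataSpace.secondCountableTopology (hΞ : Ξ.IsDataSpace) : SecondCountableTopology X := by
  have : ProperSpace X := .of_isCompact_closedBall_of_le 1 fun x r hr =>
    hΞ.isCompact_closedBall x r (by linarith)
  infer_instance

theorem memLp_φ (k : ℕ) {p : ℝ≥0∞} (hp : 1 ≤ p) : MemLp (Ξ.φ k) p Ξ.μ := by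
  refine ⟨(Ξ.φ_integrable k).1, (eLpNorm_le_max_one_top hp).trans_lt (max_lt ?_ ?_)⟩
  · exact (memLp_one_iff_integrable.2 (Ξ.φ_integrable k)).2
  · exact (memLp_top_of_bound (Ξ.φ_integrable k).1 ‖(Ξ.φ k).toBCF‖
      (ae_of_all _ fun x => (Ξ.φ k).toBCF.norm_coe_le_norm x)).2

theorem integrable_mul_φ {f : X → ℝ} {p : ℝ≥0∞} (hp : 1 ≤ p) (hf : MemLp f p Ξ.μ) (k : ℕ) :
    Integrable (fun x => f x * Ξ.φ k x) Ξ.μ := by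
  refine ⟨hf.1.mul (Ξ.φ_integrable k).1, (enorm_integral_mul_le hf.1 (Ξ.φ_integrable k).1
    hp).trans_lt (ENNReal.mul_lt_top hf.2 (max_lt ?_ ?_))⟩
  · exact (memLp_φ k le_rfl).2
  · exact (memLp_φ k le_top).2

/-- The Fourier coefficients with respect to the system `φ_k`. -/
def coeff (Ξ : DiffusionSystem X) (f : X → ℝ) (k : ℕ) : ℝ := ∫ x, f x * Ξ.φ k x ∂Ξ.μ

theorem netOp_kernelΦ {h : ℝ → ℝ} (hh : IsLowPassFilter h) {N : ℝ} (hN : 0 < N) {f : X → ℝ}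
    {p : ℝ≥0∞} (hp : 1 ≤ p) (hf : MemLp f p Ξ.μ) (x : X) :
    Ξ.netOp (Ξ.kernelΦ h N) f x =
      ∑ k ∈ Ξ.idx N, h (Ξ.lam k / N) * Ξ.coeff f k * Ξ.φ k x := by
  simp only [netOp, Ξ.kernelΦ_eq_sum hh hN, Finset.mul_sum]
  have e : ∀ y k, f y * (h (Ξ.lam k / N) * Ξ.φ k x * Ξ.φ k y) =
      h (Ξ.lam k / N) * Ξ.φ k x * (f y * Ξ.φ k y) := fun y k => by ring
  simp only [e]
  rw [integral_finsetSum _ fun k _ => (integrable_mul_φ hp hf k).const_mul _]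
  refine Finset.sum_congr rfl fun k _ => ?_
  rw [integral_const_mul, coeff]
  ring

theorem sum_smul_φ_mem {n : ℝ} {s : Finset ℕ} (hs : ∀ k ∈ s, Ξ.lam k < n) (c : ℕ → ℝ) :
    ∑ k ∈ s, c k • Ξ.φ k ∈ Ξ.diffPoly n :=
  Submodule.sum_mem _ fun k hk => Submodule.smul_mem _ _
    (Submodule.subset_span ⟨k, hs k hk, rfl⟩)

theorem diffPoly_mono {m n : ℝ} (hmn : m ≤ n) : Ξ.diffPoly m ≤ Ξ.diffPoly n :=
  Submodule.span_mono (Set.image_mono fun _ (hk : _ < m) => hk.trans_le hmn)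

theorem diffPoly_eq_sum {n : ℝ} {P : C₀(X, ℝ)} (hP : P ∈ Ξ.diffPoly n) :
    (∀ x, P x = ∑ k ∈ Ξ.idx n, Ξ.coeff P k * Ξ.φ k x) ∧ ∀ k, n ≤ Ξ.lam k → Ξ.coeff P k = 0 := by
  have hs : {k | Ξ.lam k < n} = (Ξ.idx n : Set ℕ) := by simp [idx]
  rw [diffPoly, hs, Submodule.mem_span_image_finset_iff_exists_fun] at hP
  obtain ⟨c, rfl⟩ : ∃ c : ℕ → ℝ, ∑ k ∈ Ξ.idx n, c k • Ξ.φ k = P := by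
    obtain ⟨c, rfl⟩ := hP
    refine ⟨fun k => if hk : k ∈ Ξ.idx n then c ⟨k, hk⟩ else 0, ?_⟩
    rw [← Finset.sum_coe_sort]
    exact Finset.sum_congr rfl fun i _ => by simp
  have hc : ∀ k, Ξ.coeff (∑ i ∈ Ξ.idx n, c i • Ξ.φ i : C₀(X, ℝ)) k =
      if k ∈ Ξ.idx n then c k else 0 := fun k => by
    simp only [coeff, ZeroAtInftyContinuousMap.sum_smul_apply, Finset.sum_mul, mul_assoc]
    rw [integral_finsetSum _ fun i _ =>
      (integrable_mul_φ le_rfl (memLp_φ i le_rfl) k).const_mul _]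
    simp only [integral_const_mul, Ξ.φ_orthonormal, mul_ite, mul_one, mul_zero]
    rw [Finset.sum_ite_eq']
  refine ⟨fun x => ?_, fun k hk => ?_⟩
  · rw [ZeroAtInftyContinuousMap.sum_smul_apply]
    exact Finset.sum_congr rfl fun k hk => by rw [hc, if_pos hk]
  · rw [hc, if_neg]
    simpa using hk

theorem memLp_diffPoly {n : ℝ} {P : C₀(X, ℝ)} (hP : P ∈ Ξ.diffPoly n) {p : ℝ≥0∞} (hp : 1 ≤ p) :
    MemLp P p Ξ.μ := by
  rw [show (P : X → ℝ) = fun x => ∑ k ∈ Ξ.idx n, Ξ.coeff P k * Ξ.φ k x from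
    funext (diffPoly_eq_sum hP).1]
  exact memLp_finsetSum _ fun k _ => (memLp_φ k hp).const_mul _

/-- The operator with kernel `Φ_N` reproduces `Π_{N/2}`. -/
theorem netOp_kernelΦ_diffPoly {h : ℝ → ℝ} (hh : IsLowPassFilter h) {N : ℝ} (hN : 0 < N)
    {P : C₀(X, ℝ)} (hP : P ∈ Ξ.diffPoly (N / 2)) (x : X) :
    Ξ.netOp (Ξ.kernelΦ h N) P x = P x := by
  rw [netOp_kernelΦ hh hN le_rfl (memLp_diffPoly hP le_rfl),
    (diffPoly_eq_sum (diffPoly_mono (by linarith : N / 2 ≤ N) hP)).1]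
  refine Finset.sum_congr rfl fun k _ => ?_
  rcases lt_or_ge (Ξ.lam k) (N / 2) with hk | hk
  · rw [hh.eq_one, one_mul]
    rw [abs_of_nonneg (div_nonneg (Ξ.lam_nonneg k) hN.le), div_le_iff₀ hN]
    linarith
  · rw [(diffPoly_eq_sum hP).2 k hk]
    ring

theorem netOp_kernelΦ_eq_diffPoly {h : ℝ → ℝ} (hh : IsLowPassFilter h) {N : ℝ} (hN : 0 < N)
    {f : X → ℝ} {p : ℝ≥0∞} (hp : 1 ≤ p) (hf : MemLp f p Ξ.μ) :
    ∃ P ∈ Ξ.diffPoly N, Ξ.netOp (Ξ.kernelΦ h N) f = P := by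
  refine ⟨_, sum_smul_φ_mem (s := Ξ.idx N) (fun k hk => by simpa using hk)
    (fun k => h (Ξ.lam k / N) * Ξ.coeff f k), funext fun x => ?_⟩
  rw [netOp_kernelΦ hh hN hp hf, ZeroAtInftyContinuousMap.sum_smul_apply]

theorem measurable_kernelΦ {h : ℝ → ℝ} (hh : IsLowPassFilter h) {N : ℝ} (hN : 0 < N) :
    Measurable (Function.uncurry (Ξ.kernelΦ h N)) := by
  have : Function.uncurry (Ξ.kernelΦ h N) = fun z : X × X =>
      ∑ k ∈ Ξ.idx N, h (Ξ.lam k / N) * Ξ.φ k z.1 * Ξ.φ k z.2 :=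
    funext fun z => Ξ.kernelΦ_eq_sum hh hN z.1 z.2
  rw [this]
  exact Finset.measurable_sum _ fun k _ =>
    (measurable_const.mul ((Ξ.φ k).continuous.measurable.comp measurable_fst)).mul
      ((Ξ.φ k).continuous.measurable.comp measurable_snd)

theorem aestronglyMeasurable_netOp {Ψ : X → X → ℝ} (hΨ : Measurable (Function.uncurry Ψ))
    {f : X → ℝ} (hf : AEStronglyMeasurable f Ξ.μ) :
    AEStronglyMeasurable (Ξ.netOp Ψ f) Ξ.μ :=
  (hf.comp_snd.mul hΨ.aestronglyMeasurable :
    AEStronglyMeasurable (fun z : X × X => f z.2 * Ψ z.1 z.2) (Ξ.μ.prod Ξ.μ)).integral_prod_right'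

theorem enorm_netOp_le (Ψ : X → X → ℝ) (f : X → ℝ) (x : X) :
    ‖Ξ.netOp Ψ f x‖ₑ ≤ ∫⁻ y, ‖f y‖ₑ * ‖Ψ x y‖ₑ ∂Ξ.μ := by
  refine (enorm_integral_le_lintegral_enorm _).trans (le_of_eq ?_)
  simp_rw [enorm_mul]

theorem eLpNorm_netOp_le {Ψ : X → X → ℝ} (hΨ : Measurable (Function.uncurry Ψ)) {A : ℝ≥0∞}
    (hA : A ≠ ∞) (h₁ : ∀ x, ∫⁻ y, ‖Ψ x y‖ₑ ∂Ξ.μ ≤ A) (h₂ : ∀ y, ∫⁻ x, ‖Ψ x y‖ₑ ∂Ξ.μ ≤ A)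
    {f : X → ℝ} (hf : AEStronglyMeasurable f Ξ.μ) {p : ℝ≥0∞} (hp : 1 ≤ p) :
    eLpNorm (Ξ.netOp Ψ f) p Ξ.μ ≤ A * eLpNorm f p Ξ.μ := by
  rw [← eLpNorm_enorm f]
  refine le_trans (eLpNorm_mono_enorm fun x => ?_) (eLpNorm_lintegral_mul_le
    (k := fun x y => ‖Ψ x y‖ₑ) hΨ.enorm hA h₁ h₂ hf.enorm hp)
  rw [enorm_eq_self]
  exact enorm_netOp_le Ψ f x

/-- Where `f Ψ(x,·)` is not integrable, `netOp` takes the default value 0; as `f Φ_N(x,·)` is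
integrable, the right side is then infinite. -/
theorem enorm_netOp_sub_le {Ψ : X → X → ℝ} (hΨ : Measurable (Function.uncurry Ψ)) {h : ℝ → ℝ}
    (hh : IsLowPassFilter h) {N : ℝ} (hN : 0 < N) {f : X → ℝ} {p : ℝ≥0∞} (hp : 1 ≤ p)
    (hf : MemLp f p Ξ.μ) (x : X) :
    ‖Ξ.netOp Ψ f x - Ξ.netOp (Ξ.kernelΦ h N) f x‖ₑ ≤
      ∫⁻ y, ‖f y‖ₑ * ‖Ψ x y - Ξ.kernelΦ h N x y‖ₑ ∂Ξ.μ := by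
  have hm : ∀ {Ψ : X → X → ℝ}, Measurable (Function.uncurry Ψ) →
      AEStronglyMeasurable (fun y => f y * Ψ x y) Ξ.μ := fun hΨ =>
    hf.1.mul (hΨ.comp measurable_prodMk_left).aestronglyMeasurable
  have hi : Integrable (fun y => f y * Ξ.kernelΦ h N x y) Ξ.μ := by
    simp only [Ξ.kernelΦ_eq_sum hh hN, Finset.mul_sum]
    refine integrable_finsetSum _ fun k _ => ?_
    convert! (integrable_mul_φ hp hf k).const_mul (h (Ξ.lam k / N) * Ξ.φ k x) using 2
    ring
  have he : ∀ y, ‖f y‖ₑ * ‖Ψ x y - Ξ.kernelΦ h N x y‖ₑ =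
      ‖f y * Ψ x y - f y * Ξ.kernelΦ h N x y‖ₑ := fun y => by rw [← mul_sub, enorm_mul]
  simp_rw [he]
  by_cases hint : Integrable (fun y => f y * Ψ x y) Ξ.μ
  · rw [netOp, netOp, ← integral_sub hint hi]
    exact enorm_integral_le_lintegral_enorm _
  · have : ∫⁻ y, ‖f y * Ψ x y - f y * Ξ.kernelΦ h N x y‖ₑ ∂Ξ.μ = ∞ := by
      by_contra hne
      refine hint ?_
      have h3 : Integrable (fun y => f y * Ψ x y - f y * Ξ.kernelΦ h N x y) Ξ.μ :=
        ⟨(hm hΨ).sub hi.1, lt_top_iff_ne_top.2 hne⟩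
      convert! h3.add hi using 2
      simp
    rw [this]
    exact le_top

/-- Schur test for `Ψ_n - Φ_n`, with the sum of the two fast decreasing suprema as constant. -/
theorem exists_netOp_sub_bound {h : ℝ → ℝ} (hh : IsLowPassFilter h) {Ψ : ℕ → X → X → ℝ}
    (hΨ : ∀ n, 1 ≤ n → Measurable (Function.uncurry (Ψ n)))
    (h₁ : FastDecreasing (fun n => ⨆ x, ∫⁻ y, ‖Ψ n x y - Ξ.kernelΦ h n x y‖ₑ ∂Ξ.μ))
    (h₂ : FastDecreasing (fun n => ⨆ y, ∫⁻ x, ‖Ψ n x y - Ξ.kernelΦ h n x y‖ₑ ∂Ξ.μ)) (S : ℕ) :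
    ∃ C : ℝ≥0, ∀ n : ℕ, 1 ≤ n → ∀ (p : ℝ≥0∞), 1 ≤ p → ∀ f : X → ℝ, MemLp f p Ξ.μ →
      (n : ℝ≥0∞) ^ S *
        eLpNorm (fun x => Ξ.netOp (Ψ n) f x - Ξ.netOp (Ξ.kernelΦ h n) f x) p Ξ.μ ≤
        C * eLpNorm f p Ξ.μ := by
  obtain ⟨C₁, hC₁⟩ := h₁.exists_bound S
  obtain ⟨C₂, hC₂⟩ := h₂.exists_bound S
  refine ⟨C₁ + C₂, fun n hn p hp f hf => ?_⟩
  have hn0 : (0 : ℝ) < n := by exact_mod_cast hn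
  set a := ⨆ x, ∫⁻ y, ‖Ψ n x y - Ξ.kernelΦ h n x y‖ₑ ∂Ξ.μ with ha
  set b := ⨆ y, ∫⁻ x, ‖Ψ n x y - Ξ.kernelΦ h n x y‖ₑ ∂Ξ.μ with hb
  have hab : a + b ≠ ∞ := (ENNReal.add_lt_top.2 ⟨h₁.1 n hn, h₂.1 n hn⟩).ne
  have hk : Measurable (Function.uncurry fun x y => ‖Ψ n x y - Ξ.kernelΦ h n x y‖ₑ) :=
    ((hΨ n hn).sub (measurable_kernelΦ hh hn0)).enorm
  have key : eLpNorm (fun x => Ξ.netOp (Ψ n) f x - Ξ.netOp (Ξ.kernelΦ h n) f x) p Ξ.μ ≤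
      (a + b) * eLpNorm f p Ξ.μ := by
    rw [← eLpNorm_enorm f]
    refine le_trans (eLpNorm_mono_enorm fun x => ?_) (eLpNorm_lintegral_mul_le hk hab
      (fun x => (le_iSup (fun x => ∫⁻ y, ‖Ψ n x y - Ξ.kernelΦ h n x y‖ₑ ∂Ξ.μ) x).trans le_self_add)
      (fun y => (le_iSup (fun y => ∫⁻ x, ‖Ψ n x y - Ξ.kernelΦ h n x y‖ₑ ∂Ξ.μ) y).trans le_add_self)
      hf.1.enorm hp)
    rw [enorm_eq_self]
    exact enorm_netOp_sub_le (hΨ n hn) hh hn0 hp hf x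
  calc _ ≤ (n : ℝ≥0∞) ^ S * ((a + b) * eLpNorm f p Ξ.μ) := by gcongr
    _ = ((n : ℝ≥0∞) ^ S * a + (n : ℝ≥0∞) ^ S * b) * eLpNorm f p Ξ.μ := by ring
    _ ≤ _ := by
        rw [ENNReal.coe_add]
        gcongr
        · exact hC₁ n hn
        · exact hC₂ n hn

theorem Bounds.exists_netOp_bound {h : ℝ → ℝ} {K : ℕ → Set X} {Q : ℕ} (hB : Ξ.Bounds h K Q)
    (hh : IsLowPassFilter h) :
    ∃ A : ℝ≥0, ∀ n : ℕ, 1 ≤ n → ∀ (p : ℝ≥0∞), 1 ≤ p → ∀ f : X → ℝ,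
      AEStronglyMeasurable f Ξ.μ →
      eLpNorm (Ξ.netOp (Ξ.kernelΦ h n) f) p Ξ.μ ≤ A * eLpNorm f p Ξ.μ := by
  obtain ⟨A, hA⟩ := hB.kernel_bound hh
  refine ⟨A, fun n hn p hp f hf => ?_⟩
  have hn0 : (0 : ℝ) < n := by exact_mod_cast hn
  refine eLpNorm_netOp_le (measurable_kernelΦ hh hn0) ENNReal.coe_ne_top (hA n hn)
    (fun y => ?_) hf hp
  simp_rw [fun x => Ξ.kernelΦ_comm h n x y]
  exact hA n hn y

/-- Since `P ∈ Π_{n/2}` is reproduced, `f - σ(f) = (f - P) - σ(f - P)`; boundedness of `σ` and the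
infimum over `P` finish. -/
theorem Bounds.exists_approx_bound {h : ℝ → ℝ} {K : ℕ → Set X} {Q : ℕ} (hB : Ξ.Bounds h K Q)
    (hh : IsLowPassFilter h) :
    ∃ A : ℝ≥0, ∀ n : ℕ, 1 ≤ n → ∀ (p : ℝ≥0∞), 1 ≤ p → ∀ f : X → ℝ, MemLp f p Ξ.μ →
      eLpNorm (fun x => f x - Ξ.netOp (Ξ.kernelΦ h n) f x) p Ξ.μ ≤
        A * Ξ.degApprox (fun _ => 1) p f (n / 2) := by
  obtain ⟨A, hA⟩ := hB.exists_netOp_bound hh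
  refine ⟨1 + A, fun n hn p hp f hf => ?_⟩
  have hn0 : (0 : ℝ) < n := by exact_mod_cast hn
  rw [degApprox, ENNReal.mul_iInf_of_ne (by positivity) ENNReal.coe_ne_top]
  refine le_iInf fun P => ?_
  rw [ENNReal.mul_iInf_of_ne (by positivity) ENNReal.coe_ne_top]
  refine le_iInf fun hP => ?_
  simp only [mul_one]
  have hPm := memLp_diffPoly hP hp
  have hg : MemLp (fun x => f x - P x) p Ξ.μ := hf.sub hPm
  have e : ∀ x, f x - Ξ.netOp (Ξ.kernelΦ h n) f x =
      (f x - P x) - Ξ.netOp (Ξ.kernelΦ h n) (fun x => f x - P x) x := fun x => by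
    have e1 : Ξ.netOp (Ξ.kernelΦ h n) (fun x => f x - P x) x =
        Ξ.netOp (Ξ.kernelΦ h n) f x - P x := by
      rw [← netOp_kernelΦ_diffPoly hh hn0 hP x, netOp_kernelΦ hh hn0 hp hf,
        netOp_kernelΦ hh hn0 hp hg, netOp_kernelΦ hh hn0 hp hPm, ← Finset.sum_sub_distrib]
      refine Finset.sum_congr rfl fun k _ => ?_
      have : Ξ.coeff (fun x => f x - P x) k = Ξ.coeff f k - Ξ.coeff P k := by
        simp only [coeff, sub_mul]
        exact integral_sub (integrable_mul_φ hp hf k) (integrable_mul_φ hp hPm k)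
      rw [this]
      ring
    rw [e1]
    ring
  simp_rw [e]
  refine (eLpNorm_sub_le hg.1
    (aestronglyMeasurable_netOp (measurable_kernelΦ hh hn0) hg.1) hp).trans ?_
  rw [ENNReal.coe_add, ENNReal.coe_one, add_mul, one_mul]
  gcongr
  exact hA n hn p hp _ hg.1

theorem tendsto_eLpNorm_sub_netOp {h : ℝ → ℝ} {K : ℕ → Set X} {Q : ℕ} (hB : Ξ.Bounds h K Q)
    (hh : IsLowPassFilter h) {Ψ : ℕ → X → X → ℝ}
    (hΨ : ∀ n, 1 ≤ n → Measurable (Function.uncurry (Ψ n)))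
    (h₁ : FastDecreasing (fun n => ⨆ x, ∫⁻ y, ‖Ψ n x y - Ξ.kernelΦ h n x y‖ₑ ∂Ξ.μ))
    (h₂ : FastDecreasing (fun n => ⨆ y, ∫⁻ x, ‖Ψ n x y - Ξ.kernelΦ h n x y‖ₑ ∂Ξ.μ))
    {p : ℝ≥0∞} (hp : 1 ≤ p) {f : X → ℝ} (hf : Ξ.MemXp p f) :
    Tendsto (fun n : ℕ => eLpNorm (fun x => f x - Ξ.netOp (Ψ (2 ^ n)) f x) p Ξ.μ)
      atTop (𝓝 0) := by
  obtain ⟨A, hA⟩ := hB.exists_approx_bound hh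
  obtain ⟨C, hC⟩ := exists_netOp_sub_bound hh hΨ h₁ h₂ 1
  have hpow : ∀ n : ℕ, 1 ≤ 2 ^ n := fun n => Nat.one_le_two_pow
  have hbound : ∀ n : ℕ, eLpNorm (fun x => f x - Ξ.netOp (Ψ (2 ^ n)) f x) p Ξ.μ ≤
      A * Ξ.degApprox (fun _ => 1) p f (((2 ^ n : ℕ) : ℝ) / 2) +
      C * eLpNorm f p Ξ.μ / ((2 ^ n : ℕ) : ℝ≥0∞) := fun n => by
    have hn0 : (0 : ℝ) < (2 ^ n : ℕ) := by exact_mod_cast hpow n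
    have e : (fun x => f x - Ξ.netOp (Ψ (2 ^ n)) f x) =
        (fun x => f x - Ξ.netOp (Ξ.kernelΦ h (2 ^ n : ℕ)) f x) -
        fun x => Ξ.netOp (Ψ (2 ^ n)) f x - Ξ.netOp (Ξ.kernelΦ h (2 ^ n : ℕ)) f x := by
      funext x
      simp
    have m1 := aestronglyMeasurable_netOp (hΨ _ (hpow n)) hf.1.1
    have m2 := aestronglyMeasurable_netOp (measurable_kernelΦ (Ξ := Ξ) hh hn0) hf.1.1
    rw [e]
    refine (eLpNorm_sub_le (hf.1.1.sub m2) (m1.sub m2) hp).trans (add_le_add ?_ ?_)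
    · exact hA _ (hpow n) p hp f hf.1
    · have h3 := hC _ (hpow n) p hp f hf.1
      rw [pow_one] at h3
      rw [ENNReal.le_div_iff_mul_le (Or.inl (by positivity)) (Or.inl (ENNReal.natCast_ne_top _)),
        mul_comm]
      exact h3
  have hcast : Tendsto (fun n : ℕ => 2 ^ n) atTop atTop :=
    tendsto_pow_atTop_atTop_of_one_lt (one_lt_two (α := ℕ))
  have l1 : Tendsto (fun n : ℕ => A * Ξ.degApprox (fun _ => 1) p f (((2 ^ n : ℕ) : ℝ) / 2))
      atTop (𝓝 (A * 0)) := by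
    refine ENNReal.Tendsto.const_mul (hf.2.comp ?_) (Or.inr ENNReal.coe_ne_top)
    exact (tendsto_natCast_atTop_atTop.comp hcast).atTop_div_const two_pos
  have l2 : Tendsto (fun n : ℕ => C * eLpNorm f p Ξ.μ / ((2 ^ n : ℕ) : ℝ≥0∞)) atTop
      (𝓝 (C * eLpNorm f p Ξ.μ / ∞)) :=
    ENNReal.Tendsto.const_div (ENNReal.tendsto_nat_nhds_top.comp hcast)
      (Or.inr (ENNReal.mul_ne_top ENNReal.coe_ne_top hf.1.2.ne))
  have l := l1.add l2
  rw [mul_zero, ENNReal.div_top, add_zero] at l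
  exact tendsto_of_tendsto_of_tendsto_of_le_of_le tendsto_const_nhds l (fun _ => zero_le) hbound

theorem ofReal_two_rpow (γ : ℝ) (n : ℕ) :
    ENNReal.ofReal ((2 : ℝ) ^ ((n : ℝ) * γ)) = ENNReal.ofReal ((2 : ℝ) ^ γ) ^ n := by
  rw [← ENNReal.ofReal_pow (by positivity), ← Real.rpow_natCast, ← Real.rpow_mul (by norm_num),
    mul_comm]

/-- The local errors and the local frame coefficients control each other. -/
theorem exists_errSup_tauSup_const {γ : ℝ} (hγ : 0 < γ) :
    ∃ c : ℝ≥0, ∀ {X : Type*} [MetricSpace X] [MeasurableSpace X] [BorelSpace X]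
      (Ξ : DiffusionSystem X) (p : ℝ≥0∞), 1 ≤ p → ∀ (Ψ : ℕ → X → X → ℝ),
      (∀ n, 1 ≤ n → Measurable (Function.uncurry (Ψ n))) → ∀ f : X → ℝ, MemLp f p Ξ.μ →
      Tendsto (fun n : ℕ => eLpNorm (fun x => f x - Ξ.netOp (Ψ (2 ^ n)) f x) p Ξ.μ)
        atTop (𝓝 0) → ∀ (x₀ : X) (r : ℝ),
      Ξ.errSup Ψ γ p x₀ r f ≤ c * Ξ.tauSup Ψ γ p x₀ r f 1 ∧
      Ξ.tauSup Ψ γ p x₀ r f 1 ≤ c * Ξ.errSup Ψ γ p x₀ r f ∧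
      Ξ.ballNorm p x₀ r f + Ξ.errSup Ψ γ p x₀ r f ≤ c * Ξ.tauSup Ψ γ p x₀ r f 0 ∧
      Ξ.tauSup Ψ γ p x₀ r f 0 ≤ c * (Ξ.ballNorm p x₀ r f + Ξ.errSup Ψ γ p x₀ r f) := by
  have hρ : 1 < ENNReal.ofReal ((2 : ℝ) ^ γ) := by
    rw [← ENNReal.ofReal_one]
    exact ENNReal.ofReal_lt_ofReal_iff (by positivity) |>.2
      (Real.one_lt_rpow one_lt_two hγ)
  obtain ⟨c, hc⟩ := exists_telescoping_const hρ ENNReal.ofReal_ne_top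
  refine ⟨c, fun {X} _ _ _ Ξ p hp Ψ hΨ f hf hlim x₀ r => ?_⟩
  simp only [errSup, tauSup, ofReal_two_rpow]
  have hg : ∀ n : ℕ, AEStronglyMeasurable (Ξ.netOp (Ψ (2 ^ n)) f)
      (Ξ.μ.restrict (Metric.closedBall x₀ r)) := fun n =>
    (aestronglyMeasurable_netOp (hΨ _ Nat.one_le_two_pow) hf.1).restrict
  have hf' : AEStronglyMeasurable f (Ξ.μ.restrict (Metric.closedBall x₀ r)) := hf.1.restrict
  have h0 : Ξ.netTau Ψ f 0 = Ξ.netOp (Ψ (2 ^ 0)) f := by rw [pow_zero]; rfl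
  have htri : ∀ {u v w : X → ℝ}, (∀ x, u x = v x + w x) →
      AEStronglyMeasurable v (Ξ.μ.restrict (Metric.closedBall x₀ r)) →
      AEStronglyMeasurable w (Ξ.μ.restrict (Metric.closedBall x₀ r)) →
      Ξ.ballNorm p x₀ r u ≤ Ξ.ballNorm p x₀ r v + Ξ.ballNorm p x₀ r w := by
    intro u v w huvw hv hw
    rw [show u = v + w from funext huvw]
    exact eLpNorm_add_le hv hw hp
  have hneg : ∀ n, Ξ.ballNorm p x₀ r (fun x => Ξ.netOp (Ψ (2 ^ n)) f x - f x) =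
      Ξ.ballNorm p x₀ r (fun x => f x - Ξ.netOp (Ψ (2 ^ n)) f x) := fun n =>
    eLpNorm_sub_comm _ _ _ _
  refine hc (fun n => Ξ.ballNorm p x₀ r fun x => f x - Ξ.netOp (Ψ (2 ^ n)) f x)
    (fun j => Ξ.ballNorm p x₀ r (Ξ.netTau Ψ f j)) (Ξ.ballNorm p x₀ r f) (fun n => ?_) (fun n => ?_)
    ?_ ?_ ?_
  · exact htri (fun x => by simp [netTau]) ((hg (n + 1)).sub (hg n)) (hf'.sub (hg (n + 1)))
  · rw [← hneg (n + 1)]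
    exact htri (fun x => by simp [netTau]) (hf'.sub (hg n)) ((hg (n + 1)).sub hf')
  · simp only [h0]
    exact htri (fun x => by simp) (hg 0) (hf'.sub (hg 0))
  · simp only [h0]
    rw [← hneg 0]
    exact htri (fun x => by simp) hf' ((hg 0).sub hf')
  · exact tendsto_of_tendsto_of_tendsto_of_le_of_le tendsto_const_nhds hlim (fun _ => zero_le)
      fun n => eLpNorm_mono_measure _ Measure.restrict_le_self

end DiffusionSystem

/-! ### Products of diffusion polynomials and local smoothness from local approximation -/

theorem MeasureTheory.eLpNorm_mul_le_top_mul {α : Type*} [MeasurableSpace α] {μ : Measure α}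
    (p : ℝ≥0∞) (f : α → ℝ) {g : α → ℝ} (hg : AEStronglyMeasurable g μ) :
    eLpNorm (fun x => f x * g x) p μ ≤ eLpNorm f ∞ μ * eLpNorm g p μ := by
  have := eLpNorm_le_eLpNorm_top_mul_eLpNorm p f hg (fun a b => a * b) 1
    (ae_of_all _ fun x => by simp)
  simpa using this

namespace DiffusionSystem

variable {X : Type*} [MetricSpace X] [MeasurableSpace X] [BorelSpace X] {Ξ : DiffusionSystem X}

/-- As each `φ_k` has unit `L²` norm, the count is the integral of the Christoffel function, at most
the supremum of its root times the integral of that root. -/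
theorem Bounds.exists_card_idx_le {h : ℝ → ℝ} {K : ℕ → Set X} {Q : ℕ} (hB : Ξ.Bounds h K Q) :
    ∃ C : ℝ≥0, ∀ n : ℕ, 1 ≤ n →
      ((Ξ.idx n).card : ℝ≥0∞) ≤ C * (n : ℝ≥0∞) ^ (2 * Q) := by
  obtain ⟨C₁, h1⟩ := hB.sqrtChr_le
  obtain ⟨C₂, h2⟩ := hB.lintegral_le
  refine ⟨C₁ * C₂, fun n hn => ?_⟩
  have hint : ∀ k, ∫⁻ x, ENNReal.ofReal (Ξ.φ k x ^ 2) ∂Ξ.μ = 1 := fun k => by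
    have hi := integrable_mul_φ le_rfl (memLp_φ (Ξ := Ξ) k le_rfl) k
    have := Ξ.φ_orthonormal k k
    simp only [if_true, ← sq] at this hi
    rw [← ofReal_integral_eq_lintegral_ofReal hi (ae_of_all _ fun x => sq_nonneg _), this,
      ENNReal.ofReal_one]
  calc ((Ξ.idx n).card : ℝ≥0∞) = ∑ k ∈ Ξ.idx n, ∫⁻ x, ENNReal.ofReal (Ξ.φ k x ^ 2) ∂Ξ.μ := by
        simp [hint]
    _ = ∫⁻ x, ∑ k ∈ Ξ.idx n, ENNReal.ofReal (Ξ.φ k x ^ 2) ∂Ξ.μ := by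
        rw [lintegral_finsetSum]
        exact fun k _ => ((Ξ.φ k).continuous.pow 2).measurable.ennreal_ofReal
    _ = ∫⁻ x, Ξ.sqrtChr n x * Ξ.sqrtChr n x ∂Ξ.μ := by
        refine lintegral_congr fun x => ?_
        rw [sqrtChr, ← ENNReal.ofReal_mul (Real.sqrt_nonneg _),
          Real.mul_self_sqrt (Ξ.christoffel_nonneg _ _), christoffel_eq_sum,
          ENNReal.ofReal_sum_of_nonneg fun _ _ => sq_nonneg _]
    _ ≤ ∫⁻ x, C₁ * (n : ℝ≥0∞) ^ Q * Ξ.sqrtChr n x ∂Ξ.μ := by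
        gcongr with x
        exact h1 n hn x
    _ = C₁ * (n : ℝ≥0∞) ^ Q * ∫⁻ x, Ξ.sqrtChr n x ∂Ξ.μ :=
        lintegral_const_mul _ (Ξ.measurable_sqrtChr n)
    _ ≤ C₁ * (n : ℝ≥0∞) ^ Q * (C₂ * (n : ℝ≥0∞) ^ Q) := by
        gcongr
        exact h2 n hn
    _ = _ := by rw [ENNReal.coe_mul, two_mul, pow_add]; ring

theorem Bounds.exists_coeff_bound {h : ℝ → ℝ} {K : ℕ → Set X} {Q : ℕ} (hB : Ξ.Bounds h K Q) :
    ∃ C : ℝ≥0, ∀ n : ℕ, 1 ≤ n → ∀ k, Ξ.lam k < n → ∀ (p : ℝ≥0∞), 1 ≤ p → ∀ f : X → ℝ,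
      AEStronglyMeasurable f Ξ.μ →
      ‖Ξ.coeff f k‖ₑ ≤ C * (n : ℝ≥0∞) ^ Q * eLpNorm f p Ξ.μ := by
  obtain ⟨C₁, h1⟩ := hB.sqrtChr_le
  obtain ⟨C₂, h2⟩ := hB.lintegral_le
  refine ⟨C₁ + C₂, fun n hn k hk p hp f hf => ?_⟩
  refine (enorm_integral_le_lintegral_enorm _).trans
    ((enorm_integral_mul_le hf (Ξ.φ_integrable k).1 hp).trans ?_)
  rw [mul_comm]
  gcongr
  refine max_le ?_ ?_
  · rw [eLpNorm_one_eq_lintegral_enorm]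
    refine (lintegral_mono fun x => Ξ.enorm_φ_le hk x).trans ((h2 n hn).trans ?_)
    gcongr
    simp
  · rw [eLpNorm_exponent_top]
    refine essSup_le_of_ae_le _ (ae_of_all _ fun x =>
      ((Ξ.enorm_φ_le hk x).trans (h1 n hn x)).trans (mul_le_mul' (by simp) le_rfl))

/-- Products of diffusion polynomials are, up to a negligible error, in `Π_{A n} φ_0`. -/
theorem Bounds.exists_product_bound {h : ℝ → ℝ} {K : ℕ → Set X} {Q : ℕ} (hB : Ξ.Bounds h K Q)
    (hprod : Ξ.ProductAssumption) : ∃ A : ℝ, 1 ≤ A ∧ ∀ S : ℕ, ∃ C : ℝ≥0, ∀ n : ℕ, 1 ≤ n →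
      ∀ P ∈ Ξ.diffPoly n, ∀ P' ∈ Ξ.diffPoly n, ∀ (p : ℝ≥0∞), 1 ≤ p →
      ∃ T ∈ Ξ.diffPoly (A * n),
        (n : ℝ≥0∞) ^ S * eLpNorm (fun x => P' x * P x - T x * Ξ.φ 0 x) p Ξ.μ ≤
          C * (eLpNorm P' ∞ Ξ.μ * eLpNorm P p Ξ.μ) := by
  obtain ⟨A, R, hA, hR, hfast⟩ := hprod
  obtain ⟨C₁, h1⟩ := hB.exists_card_idx_le
  obtain ⟨C₂, h2⟩ := hB.exists_coeff_bound
  refine ⟨A, hA, fun S => ?_⟩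
  -- `2 * Q` pays for the two coefficients of each term, `2 * (2 * Q)` for the number of index
  -- pairs.
  obtain ⟨C₃, h3⟩ := hfast.exists_bound (S + 2 * Q + 2 * (2 * Q))
  refine ⟨C₁ ^ 2 * C₂ ^ 2 * C₃, fun n hn P hP P' hP' p hp => ?_⟩
  set s := Ξ.idx n ×ˢ Ξ.idx n with hs
  set c : ℕ × ℕ → ℝ := fun i => Ξ.coeff P' i.1 * Ξ.coeff P i.2 with hc
  set g : ℕ × ℕ → X → ℝ := fun i x =>
    Ξ.φ i.2 x * Ξ.φ i.1 x - R i.1 i.2 n x * Ξ.φ 0 x with hg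
  set δ := ⨆ (j : ℕ) (_ : Ξ.lam j < n) (k : ℕ) (_ : Ξ.lam k < n),
    max (eLpNorm (fun x => Ξ.φ k x * Ξ.φ j x - R j k n x * Ξ.φ 0 x) 1 Ξ.μ)
      (eLpNorm (fun x => Ξ.φ k x * Ξ.φ j x - R j k n x * Ξ.φ 0 x) ∞ Ξ.μ) with hδ
  refine ⟨∑ i ∈ s, c i • R i.1 i.2 n, Submodule.sum_mem _ fun i _ =>
    Submodule.smul_mem _ _ (hR _ _ _), ?_⟩
  have e : (fun x => P' x * P x - (∑ i ∈ s, c i • R i.1 i.2 n : C₀(X, ℝ)) x * Ξ.φ 0 x) =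
      ∑ i ∈ s, c i • g i := by
    funext x
    rw [ZeroAtInftyContinuousMap.sum_smul_apply, (diffPoly_eq_sum hP).1, (diffPoly_eq_sum hP').1,
      Finset.sum_mul_sum, ← Finset.sum_product', Finset.sum_mul, ← Finset.sum_sub_distrib,
      Finset.sum_apply]
    refine Finset.sum_congr rfl fun i _ => ?_
    simp only [hc, hg, Pi.smul_apply, smul_eq_mul]
    ring
  have hgm : ∀ i, AEStronglyMeasurable (g i) Ξ.μ := fun i =>
    (((Ξ.φ i.2).continuous.mul (Ξ.φ i.1).continuous).sub
      ((R i.1 i.2 n).continuous.mul (Ξ.φ 0).continuous)).measurable.aestronglyMeasurable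
  have hgle : ∀ i ∈ s, eLpNorm (g i) p Ξ.μ ≤ δ := fun i hi => by
    rw [hs, Finset.mem_product, mem_idx, mem_idx] at hi
    refine (eLpNorm_le_max_one_top hp).trans ?_
    exact le_iSup₂_of_le i.1 hi.1 (le_iSup₂_of_le i.2 hi.2 le_rfl)
  have hcle : ∀ i ∈ s, ‖c i‖ₑ ≤ (C₂ * (n : ℝ≥0∞) ^ Q * eLpNorm P' ∞ Ξ.μ) *
      (C₂ * (n : ℝ≥0∞) ^ Q * eLpNorm P p Ξ.μ) := fun i hi => by
    rw [hs, Finset.mem_product, mem_idx, mem_idx] at hi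
    rw [hc, enorm_mul]
    exact mul_le_mul' (h2 n hn _ hi.1 _ le_top _ (memLp_diffPoly hP' le_top).1)
      (h2 n hn _ hi.2 _ hp _ (memLp_diffPoly hP hp).1)
  rw [e]
  calc _ ≤ (n : ℝ≥0∞) ^ S * ∑ i ∈ s, eLpNorm (c i • g i) p Ξ.μ := by
        gcongr
        exact eLpNorm_sum_le (fun i _ => (hgm i).const_smul _) hp
    _ ≤ (n : ℝ≥0∞) ^ S * ∑ _i ∈ s, ((C₂ * (n : ℝ≥0∞) ^ Q * eLpNorm P' ∞ Ξ.μ) *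
          (C₂ * (n : ℝ≥0∞) ^ Q * eLpNorm P p Ξ.μ)) * δ := by
        gcongr with i hi
        rw [eLpNorm_const_smul]
        exact mul_le_mul' (hcle i hi) (hgle i hi)
    _ = ((Ξ.idx n).card : ℝ≥0∞) ^ 2 * ((n : ℝ≥0∞) ^ (S + 2 * Q) * C₂ ^ 2 * δ *
          (eLpNorm P' ∞ Ξ.μ * eLpNorm P p Ξ.μ)) := by
        rw [Finset.sum_const, hs, Finset.card_product, nsmul_eq_mul]
        push_cast
        ring
    _ ≤ (C₁ * (n : ℝ≥0∞) ^ (2 * Q)) ^ 2 * ((n : ℝ≥0∞) ^ (S + 2 * Q) * C₂ ^ 2 * δ *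
          (eLpNorm P' ∞ Ξ.μ * eLpNorm P p Ξ.μ)) := by
        gcongr
        exact h1 n hn
    _ = C₁ ^ 2 * C₂ ^ 2 * ((n : ℝ≥0∞) ^ (S + 2 * Q + 2 * (2 * Q)) * δ) *
          (eLpNorm P' ∞ Ξ.μ * eLpNorm P p Ξ.μ) := by ring
    _ ≤ _ := by
        push_cast
        gcongr
        exact h3 n hn

/-- Smoothness can be tested on dyadic degrees. -/
theorem memSobolev_of_dyadic {γ : ℝ} (hγ : 0 < γ) {p : ℝ≥0∞} {w f : X → ℝ} (hf : MemLp f p Ξ.μ)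
    {A : ℝ} (hA : 1 ≤ A) {C : ℝ≥0∞} (hC : C < ∞)
    (h : ∀ j : ℕ, ENNReal.ofReal ((2 : ℝ) ^ ((j : ℝ) * γ)) *
      Ξ.degApprox w p f (A * (2 ^ j : ℕ)) ≤ C) : Ξ.MemSobolev γ p w f := by
  refine ⟨hf, lt_of_le_of_lt (b := ENNReal.ofReal (A ^ γ) * eLpNorm f p Ξ.μ +
    ENNReal.ofReal ((2 * A) ^ γ) * C) ?_ ?_⟩
  · refine iSup₂_le fun m hm => ?_
    -- Below `A` the zero polynomial is good enough; above, pick `j` with `A 2^j ≤ m < 2A 2^j`.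
    rcases lt_or_ge m A with hmA | hmA
    · refine le_add_right (mul_le_mul' (ENNReal.ofReal_le_ofReal (by gcongr)) ?_)
      refine (iInf₂_le 0 (Submodule.zero_mem _)).trans (le_of_eq ?_)
      simp
    · refine le_add_left ?_
      obtain ⟨j, hj1, hj2⟩ := exists_nat_pow_near (show 1 ≤ m / A by
        rw [le_div_iff₀ (by linarith)]; linarith) (one_lt_two (α := ℝ))
      rw [le_div_iff₀ (by linarith)] at hj1
      rw [div_lt_iff₀ (by linarith)] at hj2
      have hA0 : 0 < A := by linarith
      have e1 : m ^ γ ≤ (2 * A) ^ γ * (2 : ℝ) ^ ((j : ℝ) * γ) := by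
        rw [Real.rpow_mul (by norm_num), Real.rpow_natCast, ← Real.mul_rpow (by positivity)
          (by positivity)]
        refine Real.rpow_le_rpow hm.le ?_ hγ.le
        rw [pow_succ] at hj2
        linarith
      have e2 : Ξ.degApprox w p f m ≤ Ξ.degApprox w p f (A * (2 ^ j : ℕ)) :=
        le_iInf₂ fun P hP => iInf₂_le P
          (diffPoly_mono (show A * (2 ^ j : ℕ) ≤ m by push_cast; linarith) hP)
      calc _ ≤ ENNReal.ofReal ((2 * A) ^ γ * (2 : ℝ) ^ ((j : ℝ) * γ)) *
            Ξ.degApprox w p f (A * (2 ^ j : ℕ)) :=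
            mul_le_mul' (ENNReal.ofReal_le_ofReal e1) e2
        _ = ENNReal.ofReal ((2 * A) ^ γ) * (ENNReal.ofReal ((2 : ℝ) ^ ((j : ℝ) * γ)) *
            Ξ.degApprox w p f (A * (2 ^ j : ℕ))) := by
            rw [ENNReal.ofReal_mul (by positivity), mul_assoc]
        _ ≤ _ := by gcongr; exact h j
  · exact ENNReal.add_lt_top.2 ⟨ENNReal.mul_lt_top ENNReal.ofReal_lt_top hf.2,
      ENNReal.mul_lt_top ENNReal.ofReal_lt_top hC⟩

/-- `degApprox` is an infimum; the slack 1 in the constant yields an actual polynomial without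
attainment. -/
theorem MemSobolev.exists_approx {γ : ℝ} {p : ℝ≥0∞} {w f : X → ℝ} (hf : Ξ.MemSobolev γ p w f) :
    ∃ W : ℝ≥0, ∀ n : ℝ, 0 < n → ∃ P ∈ Ξ.diffPoly n,
      ENNReal.ofReal (n ^ γ) * eLpNorm (fun x => f x - P x * w x) p Ξ.μ ≤ W := by
  set W₀ := ⨆ (n : ℝ) (_ : 0 < n), ENNReal.ofReal (n ^ γ) * Ξ.degApprox w p f n with hW₀
  have hW : W₀ ≠ ∞ := hf.2.ne
  refine ⟨W₀.toNNReal + 1, fun n hn => ?_⟩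
  have hn' : ENNReal.ofReal (n ^ γ) ≠ 0 := by
    rw [Ne, ENNReal.ofReal_eq_zero, not_le]
    positivity
  have h1 : ENNReal.ofReal (n ^ γ) * Ξ.degApprox w p f n ≤ W₀ :=
    le_iSup₂ (f := fun (n : ℝ) (_ : 0 < n) => ENNReal.ofReal (n ^ γ) * Ξ.degApprox w p f n) n hn
  have h2 : Ξ.degApprox w p f n < (W₀ + 1) / ENNReal.ofReal (n ^ γ) := by
    rw [ENNReal.lt_div_iff_mul_lt (Or.inl hn') (Or.inl ENNReal.ofReal_ne_top), mul_comm]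
    exact h1.trans_lt (ENNReal.lt_add_right hW one_ne_zero)
  simp only [degApprox, iInf_lt_iff] at h2
  obtain ⟨P, hP, hlt⟩ := h2
  refine ⟨P, hP, ?_⟩
  rw [ENNReal.lt_div_iff_mul_lt (Or.inl hn') (Or.inl ENNReal.ofReal_ne_top), mul_comm] at hlt
  rw [ENNReal.coe_add, ENNReal.coe_toNNReal hW, ENNReal.coe_one]
  exact hlt.le

theorem two_pow_cast_rpow (γ : ℝ) (j : ℕ) : ((2 ^ j : ℕ) : ℝ) ^ γ = (2 : ℝ) ^ ((j : ℝ) * γ) := by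
  rw [Real.rpow_mul (by norm_num), Real.rpow_natCast]
  push_cast
  rfl

theorem ofReal_two_rpow_le {γ : ℝ} {S : ℕ} (hS : γ ≤ S) (j : ℕ) :
    ENNReal.ofReal ((2 : ℝ) ^ ((j : ℝ) * γ)) ≤ ((2 ^ j : ℕ) : ℝ≥0∞) ^ S := by
  rw [← two_pow_cast_rpow, ← ENNReal.ofReal_natCast, ← ENNReal.ofReal_pow (Nat.cast_nonneg _),
    ← Real.rpow_natCast]
  refine ENNReal.ofReal_le_ofReal (Real.rpow_le_rpow_of_exponent_le ?_ hS)
  exact_mod_cast Nat.one_le_two_pow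

theorem eLpNorm_eq_ballNorm {f : X → ℝ} {x₀ : X} {r : ℝ} {p : ℝ≥0∞}
    (hf : ∀ y, y ∉ Metric.closedBall x₀ r → f y = 0) :
    eLpNorm f p Ξ.μ = Ξ.ballNorm p x₀ r f := by
  rw [ballNorm, ← eLpNorm_indicator_eq_eLpNorm_restrict Metric.isClosed_closedBall.measurableSet]
  congr 1
  funext y
  by_cases hy : y ∈ Metric.closedBall x₀ r
  · rw [Set.indicator_of_mem hy]
  · rw [Set.indicator_of_notMem hy, hf y hy]

/-- A function with good local approximation by the operators with kernels `Ψ_n` is locally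
smooth. -/
theorem memLocalSobolev_of_errSup_lt_top {h : ℝ → ℝ} {K : ℕ → Set X} {Q : ℕ}
    (hB : Ξ.Bounds h K Q) (hh : IsLowPassFilter h) (hprod : Ξ.ProductAssumption)
    {Ψ : ℕ → X → X → ℝ} (hΨ : ∀ n, 1 ≤ n → Measurable (Function.uncurry (Ψ n)))
    (h₁ : FastDecreasing (fun n => ⨆ x, ∫⁻ y, ‖Ψ n x y - Ξ.kernelΦ h n x y‖ₑ ∂Ξ.μ))
    (h₂ : FastDecreasing (fun n => ⨆ y, ∫⁻ x, ‖Ψ n x y - Ξ.kernelΦ h n x y‖ₑ ∂Ξ.μ))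
    {γ : ℝ} (hγ : 0 < γ) {p : ℝ≥0∞} (hp : 1 ≤ p) {f : X → ℝ} (hf : MemLp f p Ξ.μ) {x₀ : X} {r : ℝ}
    (hr : 0 < r) (hE : Ξ.errSup Ψ γ p x₀ r f < ∞) :
    Ξ.MemLocalSobolev γ p (fun x => Ξ.φ 0 x) f x₀ := by
  refine ⟨r, hr, fun ψ hψ => ?_⟩
  obtain ⟨S, hS⟩ := exists_nat_ge γ
  obtain ⟨A, hA, hprodS⟩ := hB.exists_product_bound hprod
  obtain ⟨C₁, hC₁⟩ := hprodS S
  obtain ⟨C₂, hC₂⟩ := exists_netOp_sub_bound hh hΨ h₁ h₂ S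
  obtain ⟨C₃, hC₃⟩ := hB.exists_netOp_bound hh
  obtain ⟨W, hW⟩ := (hψ.1 γ hγ).exists_approx
  have hψLp : MemLp ψ ∞ Ξ.μ := (hψ.1 γ hγ).1
  set M := eLpNorm ψ ∞ Ξ.μ with hM
  set F := eLpNorm f p Ξ.μ with hF
  set E := Ξ.errSup Ψ γ p x₀ r f with hEdef
  have hMt : M < ∞ := hψLp.2
  have hFt : F < ∞ := hf.2
  refine memSobolev_of_dyadic hγ (hf.mul hψLp) hA
    (C := M * E + M * (C₂ * F) + W * (C₃ * F) + C₁ * ((M + W) * (C₃ * F)))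
    (by finiteness) fun j => ?_
  set n : ℕ := 2 ^ j with hn
  have hn1 : 1 ≤ n := Nat.one_le_two_pow
  have hn0 : (0 : ℝ) < n := by exact_mod_cast hn1
  set ω := ENNReal.ofReal ((2 : ℝ) ^ ((j : ℝ) * γ)) with hω
  have hω1 : 1 ≤ ω := by
    rw [hω, ← ENNReal.ofReal_one]
    exact ENNReal.ofReal_le_ofReal (Real.one_le_rpow one_le_two (by positivity))
  have hωS : ω ≤ (n : ℝ≥0∞) ^ S := ofReal_two_rpow_le hS j
  obtain ⟨P', hP', hPW⟩ := hW n hn0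
  simp only [mul_one] at hPW
  rw [hn, two_pow_cast_rpow, ← hω] at hPW
  obtain ⟨P, hP, hPf⟩ := netOp_kernelΦ_eq_diffPoly hh hn0 hp hf
  obtain ⟨T, hT, hTle⟩ := hC₁ n hn1 P hP P' hP' p hp
  have hPF : eLpNorm P p Ξ.μ ≤ C₃ * F := by
    rw [← hPf]
    exact hC₃ n hn1 p hp f hf.1
  have hPm := (memLp_diffPoly hP hp).1
  have hPm' := (memLp_diffPoly hP' le_top).1
  have hψP : eLpNorm (fun x => ψ x - P' x) ∞ Ξ.μ ≤ W := (le_mul_of_one_le_left' hω1).trans hPW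
  have hP'M : eLpNorm P' ∞ Ξ.μ ≤ M + W := by
    rw [show (P' : X → ℝ) = ψ - fun x => ψ x - P' x by funext x; simp]
    exact (eLpNorm_sub_le hψLp.1 (hψLp.1.sub hPm') le_top).trans (add_le_add le_rfl hψP)
  have hgm := aestronglyMeasurable_netOp (hΨ n hn1) hf.1
  have hφ0 : AEStronglyMeasurable (Ξ.φ 0) Ξ.μ := (Ξ.φ_integrable 0).1
  have hTm : AEStronglyMeasurable T Ξ.μ := T.continuous.measurable.aestronglyMeasurable
  -- The difference `ψ f - T φ_0` splits into the local error (seen only on the ball, by the support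
  -- of `ψ`), the passage from `Ψ_n` to `Φ_n`, the approximation of `ψ` by `P'`, and the product
  -- error.
  set a₁ : X → ℝ := fun x => ψ x * (f x - Ξ.netOp (Ψ n) f x) with ha₁
  set a₂ : X → ℝ := fun x => ψ x * (Ξ.netOp (Ψ n) f x - Ξ.netOp (Ξ.kernelΦ h n) f x) with ha₂
  set a₃ : X → ℝ := fun x => (ψ x - P' x) * P x with ha₃
  set a₄ : X → ℝ := fun x => P' x * P x - T x * Ξ.φ 0 x with ha₄
  have m1 : AEStronglyMeasurable a₁ Ξ.μ := hψLp.1.mul (hf.1.sub hgm)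
  have m2 : AEStronglyMeasurable a₂ Ξ.μ := hψLp.1.mul (hgm.sub (hPf ▸ hPm))
  have m3 : AEStronglyMeasurable a₃ Ξ.μ := (hψLp.1.sub hPm').mul hPm
  have m4 : AEStronglyMeasurable a₄ Ξ.μ := (hPm'.mul hPm).sub (hTm.mul hφ0)
  have e : (fun x => ψ x * f x - T x * Ξ.φ 0 x) = a₁ + a₂ + a₃ + a₄ := by
    funext x
    simp only [Pi.add_apply, ha₁, ha₂, ha₃, ha₄, hPf]
    ring
  have b1 : ω * eLpNorm a₁ p Ξ.μ ≤ M * E := by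
    rw [eLpNorm_eq_ballNorm (x₀ := x₀) (r := r) fun y hy => by simp [ha₁, hψ.2 y hy]]
    calc _ ≤ ω * (M * Ξ.ballNorm p x₀ r fun x => f x - Ξ.netOp (Ψ n) f x) := by
          gcongr
          refine (eLpNorm_mul_le_top_mul p ψ (hf.1.sub hgm).restrict).trans ?_
          exact mul_le_mul' (eLpNorm_mono_measure _ Measure.restrict_le_self) le_rfl
      _ = M * (ω * Ξ.ballNorm p x₀ r fun x => f x - Ξ.netOp (Ψ n) f x) := by ring
      _ ≤ _ := by
          gcongr
          exact le_iSup (fun n : ℕ => ENNReal.ofReal ((2 : ℝ) ^ ((n : ℝ) * γ)) *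
            Ξ.ballNorm p x₀ r (fun x => f x - Ξ.netOp (Ψ (2 ^ n)) f x)) j
  have b2 : ω * eLpNorm a₂ p Ξ.μ ≤ M * (C₂ * F) := by
    calc _ ≤ (n : ℝ≥0∞) ^ S * (M * eLpNorm (fun x => Ξ.netOp (Ψ n) f x -
            Ξ.netOp (Ξ.kernelΦ h n) f x) p Ξ.μ) :=
          mul_le_mul' hωS (eLpNorm_mul_le_top_mul p ψ (hgm.sub (hPf ▸ hPm)))
      _ = M * ((n : ℝ≥0∞) ^ S * eLpNorm (fun x => Ξ.netOp (Ψ n) f x -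
            Ξ.netOp (Ξ.kernelΦ h n) f x) p Ξ.μ) := by ring
      _ ≤ _ := mul_le_mul' le_rfl (hC₂ n hn1 p hp f hf)
  have b3 : ω * eLpNorm a₃ p Ξ.μ ≤ W * (C₃ * F) := by
    calc _ ≤ ω * (eLpNorm (fun x => ψ x - P' x) ∞ Ξ.μ * eLpNorm P p Ξ.μ) :=
          mul_le_mul' le_rfl (eLpNorm_mul_le_top_mul p _ hPm)
      _ = (ω * eLpNorm (fun x => ψ x - P' x) ∞ Ξ.μ) * eLpNorm P p Ξ.μ := by ring
      _ ≤ _ := mul_le_mul' hPW hPF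
  have b4 : ω * eLpNorm a₄ p Ξ.μ ≤ C₁ * ((M + W) * (C₃ * F)) := by
    refine (mul_le_mul' hωS le_rfl).trans (hTle.trans ?_)
    gcongr
  calc _ ≤ ω * eLpNorm (a₁ + a₂ + a₃ + a₄) p Ξ.μ := by
        rw [← e]
        gcongr
        exact iInf₂_le T hT
    _ ≤ ω * (eLpNorm a₁ p Ξ.μ + eLpNorm a₂ p Ξ.μ + eLpNorm a₃ p Ξ.μ + eLpNorm a₄ p Ξ.μ) := by
        gcongr
        refine (eLpNorm_add_le ((m1.add m2).add m3) m4 hp).trans ?_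
        gcongr
        refine (eLpNorm_add_le (m1.add m2) m3 hp).trans ?_
        gcongr
        exact eLpNorm_add_le m1 m2 hp
    _ = ω * eLpNorm a₁ p Ξ.μ + ω * eLpNorm a₂ p Ξ.μ + ω * eLpNorm a₃ p Ξ.μ +
        ω * eLpNorm a₄ p Ξ.μ := by ring
    _ ≤ _ := by gcongr

end DiffusionSystem

/-! ### Cutoffs, and local approximation from local smoothness -/

namespace DiffusionSystem

variable {X : Type*} [MetricSpace X] [MeasurableSpace X] [BorelSpace X] {Ξ : DiffusionSystem X}

theorem IsSmooth.zero : Ξ.IsSmooth fun _ => 0 := fun γ _ => by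
  refine ⟨MemLp.zero', lt_of_le_of_lt (iSup₂_le fun n _ => ?_) ENNReal.zero_lt_top⟩
  have : Ξ.degApprox (fun _ => 1) ∞ (fun _ => 0) n = 0 :=
    le_antisymm ((iInf₂_le 0 (Submodule.zero_mem _)).trans_eq
      (by rw [show (fun x => 0 - (0 : C₀(X, ℝ)) x * 1) = (0 : X → ℝ) from funext fun _ => by simp,
        eLpNorm_zero])) zero_le
  rw [this, mul_zero]

theorem IsSmooth.add {f g : X → ℝ} (hf : Ξ.IsSmooth f) (hg : Ξ.IsSmooth g) :
    Ξ.IsSmooth fun x => f x + g x := fun γ hγ => by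
  obtain ⟨W, hW⟩ := (hf γ hγ).exists_approx
  obtain ⟨V, hV⟩ := (hg γ hγ).exists_approx
  have mf := (hf γ hγ).1
  have mg := (hg γ hγ).1
  refine ⟨mf.add mg, lt_of_le_of_lt (b := (W : ℝ≥0∞) + V) (iSup₂_le fun n hn => ?_)
    (by finiteness)⟩
  obtain ⟨P, hP, hPW⟩ := hW n hn
  obtain ⟨P', hP', hPV⟩ := hV n hn
  simp only [mul_one] at hPW hPV
  refine le_trans ?_ (add_le_add hPW hPV)
  rw [← mul_add]
  gcongr
  refine (iInf₂_le (P + P') (Submodule.add_mem _ hP hP')).trans ?_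
  have e : (fun x => f x + g x - (P + P') x * 1) = (fun x => f x - P x) + fun x => g x - P' x := by
    funext x
    simp only [ZeroAtInftyContinuousMap.add_apply, Pi.add_apply]
    ring
  rw [e]
  exact eLpNorm_add_le (mf.1.sub (memLp_diffPoly hP le_top).1)
    (mg.1.sub (memLp_diffPoly hP' le_top).1) le_top

theorem IsSmooth.sum {ψ : ℕ → X → ℝ} (hψ : ∀ k, Ξ.IsSmooth (ψ k)) (F : Finset ℕ) :
    Ξ.IsSmooth fun x => ∑ k ∈ F, ψ k x := by
  induction F using Finset.induction_on with
  | empty => simpa using IsSmooth.zero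
  | insert a s ha ih =>
    simp only [Finset.sum_insert ha]
    exact (hψ a).add ih

/-- A partition of unity provides smooth cut-off functions. -/
theorem PartitionOfUnity.exists_cutoff (hPU : Ξ.PartitionOfUnity) (x₀ : X) {r : ℝ} (hr : 0 < r) :
    ∃ ψ : X → ℝ, Ξ.IsSmoothOnBall x₀ r ψ ∧ ∀ y ∈ Metric.closedBall x₀ (r / 3), ψ y = 1 := by
  classical
  obtain ⟨ψ, hψ, -, hF⟩ := hPU (r / 3) (by positivity)
  obtain ⟨F, hF⟩ := hF x₀
  -- Keeping only the functions that meet the ball of radius `r/3` leaves the sum there unchanged,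
  -- and each of these vanishes beyond distance `r/3 + 2r/3 = r` from `x₀`.
  set F' := F.filter fun k => ∃ y ∈ Metric.closedBall x₀ (r / 3), ψ k y ≠ 0 with hF'
  refine ⟨fun x => ∑ k ∈ F', ψ k x, ⟨IsSmooth.sum (fun k => (hψ k).choose_spec.1) _, ?_⟩, ?_⟩
  · intro y hy
    refine Finset.sum_eq_zero fun k hk => ?_
    obtain ⟨z, hz, hzk⟩ := (Finset.mem_filter.1 hk).2
    obtain ⟨x, -, hx⟩ := hψ k
    by_contra hyk
    have h1 : y ∈ Metric.closedBall x (r / 3) := by_contra fun hc => hyk (hx y hc)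
    have h2 : z ∈ Metric.closedBall x (r / 3) := by_contra fun hc => hzk (hx z hc)
    refine hy ?_
    rw [Metric.mem_closedBall] at h1 h2 hz ⊢
    have := dist_triangle4 y x z x₀
    rw [dist_comm x z] at this
    linarith
  · intro y hy
    rw [← hF y hy]
    refine Finset.sum_filter_of_ne fun k _ hk => ⟨y, hy, hk⟩

/-- The operators with kernels `Φ_n` are local up to a negligible error. -/
theorem Bounds.exists_localization_bound [SecondCountableTopology X] {h : ℝ → ℝ} {K : ℕ → Set X}
    {Q : ℕ} (hB : Ξ.Bounds h K Q) (hh : IsLowPassFilter h) {r : ℝ} (hr : 0 < r) (S : ℕ) :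
    ∃ C : ℝ≥0, ∀ n : ℕ, 1 ≤ n → ∀ (p : ℝ≥0∞), 1 ≤ p → ∀ (g : X → ℝ),
      AEStronglyMeasurable g Ξ.μ → ∀ x₀ : X, (∀ y ∈ Metric.closedBall x₀ (2 * r), g y = 0) →
      (n : ℝ≥0∞) ^ S * Ξ.ballNorm p x₀ r (Ξ.netOp (Ξ.kernelΦ h n) g) ≤ C * eLpNorm g p Ξ.μ := by
  obtain ⟨C, hC⟩ := hB.kernel_far hh hr S
  refine ⟨C, fun n hn p hp g hg x₀ hg0 => ?_⟩
  have hn0 : (0 : ℝ) < n := by exact_mod_cast hn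
  have hnS : (n : ℝ≥0∞) ^ S ≠ 0 := by positivity
  have hnS' : (n : ℝ≥0∞) ^ S ≠ ∞ := ENNReal.pow_ne_top (ENNReal.natCast_ne_top n)
  -- For `x` in the small ball and `y` outside the doubled one, removing the diagonal strip changes
  -- nothing. The cut kernel stays symmetric, so one bound serves both halves of the Schur test.
  set k : X → X → ℝ≥0∞ := fun x y => {y | r ≤ dist x y}.indicator
    (fun y => ‖Ξ.kernelΦ h n x y‖ₑ) y with hk
  have hkm : Measurable (Function.uncurry k) := by
    have hm : MeasurableSet {z : X × X | r ≤ dist z.1 z.2} :=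
      measurableSet_le measurable_const measurable_dist
    exact (measurable_kernelΦ (Ξ := Ξ) hh hn0).enorm.indicator hm
  have hint : ∀ x, ∫⁻ y, k x y ∂Ξ.μ ≤ C / (n : ℝ≥0∞) ^ S := fun x => by
    have hm : MeasurableSet {y | r ≤ dist x y} :=
      (isClosed_le continuous_const (continuous_const.dist continuous_id)).measurableSet
    rw [hk, lintegral_indicator hm, ENNReal.le_div_iff_mul_le (Or.inl hnS) (Or.inl hnS'), mul_comm]
    exact hC n hn x
  have hsymm : ∀ x y, k x y = k y x := fun x y => by
    simp only [hk, Set.indicator, Set.mem_ofPred_eq, dist_comm x y, Ξ.kernelΦ_comm h n x y]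
  have key : Ξ.ballNorm p x₀ r (Ξ.netOp (Ξ.kernelΦ h n) g) ≤
      C / (n : ℝ≥0∞) ^ S * eLpNorm g p Ξ.μ := by
    rw [← eLpNorm_enorm g]
    refine le_trans ?_ (eLpNorm_lintegral_mul_le hkm (ENNReal.div_ne_top ENNReal.coe_ne_top hnS)
      hint (fun y => by simp_rw [fun x => hsymm x y]; exact hint y) hg.enorm hp)
    refine le_trans (eLpNorm_mono_enorm_ae ?_) (eLpNorm_mono_measure _ Measure.restrict_le_self)
    refine (ae_restrict_iff' Metric.isClosed_closedBall.measurableSet).2 (ae_of_all _ fun x hx => ?_)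
    rw [enorm_eq_self]
    refine (enorm_netOp_le _ _ _).trans (lintegral_mono fun y => ?_)
    by_cases hy : y ∈ Metric.closedBall x₀ (2 * r)
    · simp [hg0 y hy]
    · refine mul_le_mul' le_rfl (le_of_eq ?_)
      simp only [hk]
      rw [Set.indicator_of_mem]
      rw [Metric.mem_closedBall, not_le] at hy
      rw [Metric.mem_closedBall] at hx
      have := dist_triangle y x x₀
      rw [Set.mem_ofPred_eq, dist_comm]
      linarith
  calc _ ≤ (n : ℝ≥0∞) ^ S * (C / (n : ℝ≥0∞) ^ S * eLpNorm g p Ξ.μ) := by gcongr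
    _ = _ := by rw [← mul_assoc, ENNReal.mul_div_cancel hnS hnS']

/-- Locally smooth functions are locally well approximated by the operators with kernels `Ψ_n`. -/
theorem errSup_lt_top_of_memLocalSobolev [SecondCountableTopology X] {h : ℝ → ℝ} {K : ℕ → Set X}
    {Q : ℕ} (hB : Ξ.Bounds h K Q) (hh : IsLowPassFilter h) (hPU : Ξ.PartitionOfUnity)
    {Ψ : ℕ → X → X → ℝ} (hΨ : ∀ n, 1 ≤ n → Measurable (Function.uncurry (Ψ n)))
    (h₁ : FastDecreasing (fun n => ⨆ x, ∫⁻ y, ‖Ψ n x y - Ξ.kernelΦ h n x y‖ₑ ∂Ξ.μ))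
    (h₂ : FastDecreasing (fun n => ⨆ y, ∫⁻ x, ‖Ψ n x y - Ξ.kernelΦ h n x y‖ₑ ∂Ξ.μ))
    {γ : ℝ} {p : ℝ≥0∞} (hp : 1 ≤ p) {f : X → ℝ} (hf : MemLp f p Ξ.μ) {x₀ : X}
    (hloc : Ξ.MemLocalSobolev γ p (fun _ => 1) f x₀) :
    ∃ r : ℝ, 0 < r ∧ Ξ.errSup Ψ γ p x₀ r f < ∞ := by
  obtain ⟨r, hr, hloc⟩ := hloc
  obtain ⟨ψ, hψ, hψ1⟩ := hPU.exists_cutoff x₀ hr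
  obtain ⟨hu, hW⟩ := hloc ψ hψ
  obtain ⟨S, hS⟩ := exists_nat_ge γ
  obtain ⟨A, hA⟩ := hB.exists_approx_bound hh
  -- The radius is half of `r/3`, the radius on which the cutoff is 1 and `g = f - ψ f` vanishes.
  obtain ⟨C₁, hC₁⟩ := hB.exists_localization_bound hh (show 0 < r / 6 by positivity) S
  obtain ⟨C₂, hC₂⟩ := exists_netOp_sub_bound hh hΨ h₁ h₂ S
  set u : X → ℝ := fun x => ψ x * f x with hudef
  set g : X → ℝ := fun x => f x - u x with hgdef
  have hg : MemLp g p Ξ.μ := hf.sub hu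
  set W := ⨆ (n : ℝ) (_ : 0 < n), ENNReal.ofReal (n ^ γ) * Ξ.degApprox (fun _ => 1) p u n with hWdef
  have hFt := hf.2
  have hGt := hg.2
  refine ⟨r / 6, by positivity, lt_of_le_of_lt (b := A * (ENNReal.ofReal (2 ^ γ) * W) +
    C₁ * eLpNorm g p Ξ.μ + C₂ * eLpNorm f p Ξ.μ) (iSup_le fun j => ?_) (by finiteness)⟩
  set n : ℕ := 2 ^ j with hn
  have hn1 : 1 ≤ n := Nat.one_le_two_pow
  have hn0 : (0 : ℝ) < n := by exact_mod_cast hn1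
  set ω := ENNReal.ofReal ((2 : ℝ) ^ ((j : ℝ) * γ)) with hω
  have hωS : ω ≤ (n : ℝ≥0∞) ^ S := ofReal_two_rpow_le hS j
  set ν := Ξ.μ.restrict (Metric.closedBall x₀ (r / 6)) with hν
  have hΦ := measurable_kernelΦ (Ξ := Ξ) hh hn0
  set a₁ : X → ℝ := fun x => u x - Ξ.netOp (Ξ.kernelΦ h n) u x with ha₁
  set a₂ : X → ℝ := Ξ.netOp (Ξ.kernelΦ h n) g with ha₂
  set a₃ : X → ℝ := fun x => Ξ.netOp (Ψ n) f x - Ξ.netOp (Ξ.kernelΦ h n) f x with ha₃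
  have m1 : AEStronglyMeasurable a₁ ν := (hu.1.sub (aestronglyMeasurable_netOp hΦ hu.1)).restrict
  have m2 : AEStronglyMeasurable a₂ ν := (aestronglyMeasurable_netOp hΦ hg.1).restrict
  have m3 : AEStronglyMeasurable a₃ ν := ((aestronglyMeasurable_netOp (hΨ n hn1) hf.1).sub
    (aestronglyMeasurable_netOp hΦ hf.1)).restrict
  have hsplit : ∀ x, Ξ.netOp (Ξ.kernelΦ h n) f x =
      Ξ.netOp (Ξ.kernelΦ h n) u x + Ξ.netOp (Ξ.kernelΦ h n) g x := fun x => by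
    rw [netOp_kernelΦ hh hn0 hp hf, netOp_kernelΦ hh hn0 hp hu, netOp_kernelΦ hh hn0 hp hg,
      ← Finset.sum_add_distrib]
    refine Finset.sum_congr rfl fun k _ => ?_
    have : Ξ.coeff g k = Ξ.coeff f k - Ξ.coeff u k := by
      simp only [coeff, hgdef, sub_mul]
      exact integral_sub (integrable_mul_φ hp hf k) (integrable_mul_φ hp hu k)
    rw [this]
    ring
  have e : (fun x => f x - Ξ.netOp (Ψ n) f x) =ᵐ[ν] a₁ - a₂ - a₃ := by
    refine (ae_restrict_iff' Metric.isClosed_closedBall.measurableSet).2 (ae_of_all _ fun x hx => ?_)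
    have hx1 : ψ x = 1 := hψ1 x (Metric.closedBall_subset_closedBall (by linarith) hx)
    simp only [Pi.sub_apply, ha₁, ha₂, ha₃, hsplit, hudef, hx1]
    ring
  have b1 : ω * eLpNorm a₁ p ν ≤ A * (ENNReal.ofReal (2 ^ γ) * W) := by
    -- The factor `2^γ` compensates for approximation from `Π_{n/2}` instead of `Π_n`.
    have e1 : ω = ENNReal.ofReal (2 ^ γ) * ENNReal.ofReal (((n : ℝ) / 2) ^ γ) := by
      rw [← ENNReal.ofReal_mul (by positivity), ← Real.mul_rpow (by norm_num) (by positivity),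
        mul_div_cancel₀ _ (two_ne_zero), hn, two_pow_cast_rpow]
    calc _ ≤ ω * (A * Ξ.degApprox (fun _ => 1) p u (n / 2)) := by
          gcongr
          exact (eLpNorm_mono_measure _ Measure.restrict_le_self).trans (hA n hn1 p hp u hu)
      _ = A * (ENNReal.ofReal (2 ^ γ) * (ENNReal.ofReal (((n : ℝ) / 2) ^ γ) *
          Ξ.degApprox (fun _ => 1) p u (n / 2))) := by rw [e1]; ring
      _ ≤ _ := by
          gcongr
          exact le_iSup₂ (f := fun (n : ℝ) (_ : 0 < n) =>
            ENNReal.ofReal (n ^ γ) * Ξ.degApprox (fun _ => 1) p u n) ((n : ℝ) / 2) (by positivity)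
  have b2 : ω * eLpNorm a₂ p ν ≤ C₁ * eLpNorm g p Ξ.μ := by
    refine (mul_le_mul' hωS le_rfl).trans (hC₁ n hn1 p hp g hg.1 x₀ fun y hy => ?_)
    have : ψ y = 1 := hψ1 y (Metric.closedBall_subset_closedBall (by linarith) hy)
    simp [hgdef, hudef, this]
  have b3 : ω * eLpNorm a₃ p ν ≤ C₂ * eLpNorm f p Ξ.μ :=
    (mul_le_mul' hωS (eLpNorm_mono_measure _ Measure.restrict_le_self)).trans
      (hC₂ n hn1 p hp f hf)
  calc _ = ω * eLpNorm (a₁ - a₂ - a₃) p ν := by rw [ballNorm, eLpNorm_congr_ae e]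
    _ ≤ ω * (eLpNorm a₁ p ν + eLpNorm a₂ p ν + eLpNorm a₃ p ν) := by
        gcongr
        refine (eLpNorm_sub_le (m1.sub m2) m3 hp).trans ?_
        gcongr
        exact eLpNorm_sub_le m1 m2 hp
    _ = ω * eLpNorm a₁ p ν + ω * eLpNorm a₂ p ν + ω * eLpNorm a₃ p ν := by ring
    _ ≤ _ := by gcongr

end DiffusionSystem

end

/-! ### Assembly -/

theorem corollary6p1 {X : Type*} [MetricSpace X] [ConnectedSpace X] [MeasurableSpace X]
    [BorelSpace X] (Ξ : DiffusionSystem X) (hΞ : Ξ.IsDataSpace)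
    (hPU : Ξ.PartitionOfUnity) (hprod : Ξ.ProductAssumption)
    (h : ℝ → ℝ) (hh : IsLowPassFilter h) (γ : ℝ) (hγ : 0 < γ) :
    ∃ c : ℝ≥0, ∀ (p : ℝ≥0∞), 1 ≤ p → ∀ (Ψ : ℕ → X → X → ℝ),
      (∀ n, 1 ≤ n → Measurable (Function.uncurry (Ψ n))) →
      FastDecreasing (fun n => ⨆ x, ∫⁻ y, ‖Ψ n x y - Ξ.kernelΦ h n x y‖ₑ ∂Ξ.μ) →
      FastDecreasing (fun n => ⨆ y, ∫⁻ x, ‖Ψ n x y - Ξ.kernelΦ h n x y‖ₑ ∂Ξ.μ) →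
      ∀ (f : X → ℝ), Ξ.MemXp p f → ∀ x₀ : X,
        -- (a)
        (∀ r : ℝ, 0 < r →
          Ξ.errSup Ψ γ p x₀ r f ≤ c * Ξ.tauSup Ψ γ p x₀ r f 1 ∧
          Ξ.tauSup Ψ γ p x₀ r f 1 ≤ c * Ξ.errSup Ψ γ p x₀ r f ∧
          Ξ.ballNorm p x₀ r f + Ξ.errSup Ψ γ p x₀ r f ≤ c * Ξ.tauSup Ψ γ p x₀ r f 0 ∧
          Ξ.tauSup Ψ γ p x₀ r f 0 ≤ c * (Ξ.ballNorm p x₀ r f + Ξ.errSup Ψ γ p x₀ r f)) ∧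
        -- (b)
        ((∃ r : ℝ, 0 < r ∧ (Ξ.errSup Ψ γ p x₀ r f < ∞ ∨ Ξ.tauSup Ψ γ p x₀ r f 0 < ∞)) →
          Ξ.MemLocalSobolev γ p (fun x => Ξ.φ 0 x) f x₀) ∧
        -- (c)
        (Ξ.MemLocalSobolev γ p (fun _ => 1) f x₀ →
          ∃ r : ℝ, 0 < r ∧ Ξ.errSup Ψ γ p x₀ r f < ∞ ∧ Ξ.tauSup Ψ γ p x₀ r f 0 < ∞) := by
  have := hΞ.secondCountableTopology
  obtain ⟨K, Q, hB⟩ := hΞ.exists_bounds hh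
  obtain ⟨c, hc⟩ := DiffusionSystem.exists_errSup_tauSup_const hγ
  refine ⟨c, fun p hp Ψ hΨ h₁ h₂ f hf x₀ => ?_⟩
  have ha := fun r => hc Ξ p hp Ψ hΨ f hf.1
    (DiffusionSystem.tendsto_eLpNorm_sub_netOp hB hh hΨ h₁ h₂ hp hf) x₀ r
  have hball : ∀ r, Ξ.ballNorm p x₀ r f < ∞ := fun r =>
    (eLpNorm_mono_measure _ Measure.restrict_le_self).trans_lt hf.1.2
  refine ⟨fun r _ => ha r, ?_, fun hloc => ?_⟩
  · rintro ⟨r, hr, hE⟩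
    refine DiffusionSystem.memLocalSobolev_of_errSup_lt_top hB hh hprod hΨ h₁ h₂ hγ hp hf.1 hr ?_
    -- Finiteness of the frame supremum passes to the error supremum by (a), on the same ball.
    refine hE.elim id fun hT => lt_of_le_of_lt (le_add_self.trans (ha r).2.2.1) ?_
    exact ENNReal.mul_lt_top ENNReal.coe_lt_top hT
  · obtain ⟨r, hr, hE⟩ :=
      DiffusionSystem.errSup_lt_top_of_memLocalSobolev hB hh hPU hΨ h₁ h₂ hp hf.1 hloc
    refine ⟨r, hr, hE, (ha r).2.2.2.trans_lt ?_⟩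
    exact ENNReal.mul_lt_top ENNReal.coe_lt_top (ENNReal.add_lt_top.2 ⟨hball r, hE⟩)
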